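/- **Setting.** Let $M(c)=(M^{2n+1},\phi,\xi,\eta,g)$ be a Sasakian space form with $c\neq 1$: a smooth almost contact metric manifold ($\phi^2=-I+\eta\otimes\xi$, $\eta(\xi)=1$, $g(\phi X,\phi Y)=g(X,Y)-\eta(X)\eta(Y)$) which is contact metric, $d\eta(X,Y)=g(X,\phi Y)$ with $d\eta(X,Y)=\tfrac12\big(X\eta(Y)-Y\eta(X)-\eta([X,Y])\big)$, and normal, $N_\phi=-2\,d\eta\otimes\xi$, and such that every plane spanned by a unit vector $X\perp\xi$ and $\phi X$ has sectional curvature $c$. Let $I\subset\mathbb R$ be a nonempty open interval and let $\gamma:I\to M(c)$ be a smooth Legendre curve parametrized by arc length ($T=\gamma'$, $g(T,T)=1$, $\eta(T)=0$). Assume that $\gamma$ is a Frenet curve with frame $E_1=T,E_2,\dots,E_r$, $r\ge 2$, and curvatures $k_1,\dots,k_{r-1}$: the $E_i$ are smooth orthonormal fields along $\gamma$, the $k_i\ge 0$ are smooth functions, and $\nabla_TE_i=-k_{i-1}E_{i-1}+k_iE_{i+1}$ for $1\le i\le r$, where the first term is absent for $i=1$ and the second one for $i=r$. (The curvatures are allowed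 to vanish, so that a geodesic with a suitable frame is included.) Assume that $\phi T\parallel E_2$ at every point. Let $\delta_1,\delta_2\in\mathbb R$, $\delta_2\ne 0$. The curve $\gamma$ is interpolating sesqui-harmonic (for $\delta_1,\delta_2$) if it satisfies the interpolating sesqui-harmonic map equation $\delta_2\tau_2(\gamma)-\delta_1\tau(\gamma)=0$, where $\tau(\gamma)=\nabla_TT$ and $\tau_2(\gamma)=\nabla_T\nabla_T\tau(\gamma)-R(T,\tau(\gamma))T$ with $R(X,Y)Z=\nabla_X\nabla_YZ-\nabla_Y\nabla_XZ-\nabla_{[X,Y]}Z$. It is a geodesic if $\nabla_TT=0$, and a helix if it is a Frenet curve with a frame of three fields whose two curvatures are positive constants. **Theorem.** $\{T,\phi T,\xi\}$ is the Frenet frame field of $\gamma$, up to a common sign of its last two fields: $r\ge 3$, and there is a constant $\varepsilon\in\{1,-1\}$ such that $E_1=T$, $E_2=\varepsilon\,\phi T$, $E_3=\varepsilon\,\xi$ along $\gamma$; moreover $k_2=1$, $k_3=0$ if $r>3$, and $\{T,\varepsilon\,\phi T,\varepsilon\,\xi\}$ with curvatures $k_1$ and $1$ is a Frenet frame of $\gamma$.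 In particular $r=3$ if all the curvatures $k_1,\dots,k_{r-1}$ are positive. (1) If $c<1$ and $\delta_1/\delta_2\ge 0$, then $\gamma$ is interpolating sesqui-harmonic if and only if it is a geodesic. (2) If $c>1$, $\delta_1/\delta_2<0$ and $\gamma$ is not a geodesic, then $\gamma$ is interpolating sesqui-harmonic if and only if it is a helix with $k_1^2=c-1-\delta_1/\delta_2$ and $k_2=1$. -/

import Mathlib

open scoped Manifold ContDiff
open Bundle

noncomputable section

namespace SasakianCurves

/-! ### Riemannian geometry of a metric `G` on an open subset of a vector space

A tensor field is given by its coordinate expression; a vector `u : E` also denotes the constant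
vector field `u`. -/

section Coordinates

variable {E : Type*} [NormedAddCommGroup E] [NormedSpace ℝ E]

/-- The Christoffel symbol `Γ_y(u, v) = (∇_u v)(y)` of the Levi-Civita connection of `G`, for
constant vector fields `u`, `v`: the vector `w` with
`G_y(w, z) = ½ (D_u G(v, z) + D_v G(u, z) - D_z G(u, v))` for all `z`. -/
def christoffel (G : E → E →L[ℝ] E →L[ℝ] ℝ) (y u v : E) : E :=
  (G y).inverse ((1 / 2 : ℝ) •
    (fderiv ℝ G y u v + fderiv ℝ G y v u - ((fderiv ℝ G y).flip u).flip v))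

/-- The curvature tensor `R(u, v) w = ∇_u ∇_v w - ∇_v ∇_u w - ∇_[u, v] w` of `G` at `y`,
evaluated on constant vector fields. -/
def curvature (G : E → E →L[ℝ] E →L[ℝ] ℝ) (y u v w : E) : E :=
  fderiv ℝ (fun z => christoffel G z v w) y u - fderiv ℝ (fun z => christoffel G z u w) y v
    + christoffel G y u (christoffel G y v w) - christoffel G y v (christoffel G y u w)

/-- The exterior derivative `dη(u, v) = ½ (u (η v) - v (η u) - η [u, v])` of a one-form, on constant
vector fields. -/
def extDerivOneForm (η : E → E →L[ℝ] ℝ) (y u v : E) : ℝ :=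
  (1 / 2 : ℝ) * (fderiv ℝ η y u v - fderiv ℝ η y v u)

/-- The Nijenhuis tensor `N_φ(u, v) = φ² [u, v] + [φ u, φ v] - φ [φ u, v] - φ [u, φ v]`, on constant
vector fields. -/
def nijenhuis (φ : E → E →L[ℝ] E) (y u v : E) : E :=
  φ y (φ y (VectorField.lieBracket ℝ (fun _ => u) (fun _ => v) y))
    + VectorField.lieBracket ℝ (fun z => φ z u) (fun z => φ z v) y
    - φ y (VectorField.lieBracket ℝ (fun z => φ z u) (fun _ => v) y)
    - φ y (VectorField.lieBracket ℝ (fun _ => u) (fun z => φ z v) y)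

end Coordinates

variable {E : Type*} [NormedAddCommGroup E] [NormedSpace ℝ E]
  {M : Type*} [TopologicalSpace M] [ChartedSpace E M] [IsManifold 𝓘(ℝ, E) ∞ M]

/-! ### Chart expressions of tangent vectors -/

/-- The components in the chart around `x₀` of a tangent vector at `p`
(the derivative of the chart, for `p` in its domain). -/
def toChart (x₀ p : M) : TangentSpace 𝓘(ℝ, E) p →L[ℝ] E :=
  (trivializationAt E (TangentSpace 𝓘(ℝ, E)) x₀).continuousLinearMapAt ℝ p

/-- The tangent vector at `p` with given components in the chart around `x₀`. -/
def ofChart (x₀ p : M) : E →L[ℝ] TangentSpace 𝓘(ℝ, E) p :=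
  (trivializationAt E (TangentSpace 𝓘(ℝ, E)) x₀).symmL ℝ p

/-! ### Riemannian geometry on `M` -/

/-- A smooth Riemannian metric on `M`. -/
abbrev Metric (E : Type*) [NormedAddCommGroup E] [NormedSpace ℝ E]
    (M : Type*) [TopologicalSpace M] [ChartedSpace E M] [IsManifold 𝓘(ℝ, E) ∞ M] :=
  ContMDiffRiemannianMetric 𝓘(ℝ, E) ∞ E (fun p : M => TangentSpace 𝓘(ℝ, E) p)

/-- The coefficients of the metric in the chart around `x₀`, at the point with coordinates `y`. -/
def metricInChart (g : Metric E M) (x₀ : M) (y : E) : E →L[ℝ] E →L[ℝ] ℝ :=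
  let p := (extChartAt 𝓘(ℝ, E) x₀).symm y
  (ContinuousLinearMap.precomp ℝ (ofChart x₀ p)) ∘L (g.inner p) ∘L (ofChart x₀ p)

/-- The Riemannian curvature tensor `R(X, Y) Z` at `p`. -/
def riemann (g : Metric E M) (p : M) (X Y Z : TangentSpace 𝓘(ℝ, E) p) :
    TangentSpace 𝓘(ℝ, E) p :=
  ofChart p p (curvature (metricInChart g p) (extChartAt 𝓘(ℝ, E) p p)
    (toChart p p X) (toChart p p Y) (toChart p p Z))

/-- The velocity `γ'(t)` of a curve. -/
def velocity (γ : ℝ → M) (t : ℝ) : TangentSpace 𝓘(ℝ, E) (γ t) :=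
  mfderiv 𝓘(ℝ, ℝ) 𝓘(ℝ, E) γ t (1 : ℝ)

/-- The covariant derivative `∇_T V` of a vector field `V` along the curve `γ`, `T = γ'`:
in the chart around `γ t` its components are `dV/dt + Γ(T, V)`. -/
def covDeriv (g : Metric E M) (γ : ℝ → M) (V : ∀ t, TangentSpace 𝓘(ℝ, E) (γ t)) (t : ℝ) :
    TangentSpace 𝓘(ℝ, E) (γ t) :=
  ofChart (γ t) (γ t)
    (deriv (fun s => toChart (γ t) (γ s) (V s)) t
      + christoffel (metricInChart g (γ t)) (extChartAt 𝓘(ℝ, E) (γ t) (γ t))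
          (toChart (γ t) (γ t) (velocity γ t)) (toChart (γ t) (γ t) (V t)))

/-- The tension field `τ(γ) = ∇_T T` of a curve. -/
def tension (g : Metric E M) (γ : ℝ → M) : ∀ t, TangentSpace 𝓘(ℝ, E) (γ t) :=
  covDeriv g γ (velocity γ)

/-- The bitension field `τ₂(γ) = ∇_T ∇_T τ(γ) - R(T, τ(γ)) T` of a curve. -/
def bitension (g : Metric E M) (γ : ℝ → M) (t : ℝ) : TangentSpace 𝓘(ℝ, E) (γ t) :=
  covDeriv g γ (covDeriv g γ (tension g γ)) t
    - riemann g (γ t) (velocity γ t) (tension g γ t) (velocity γ t)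

/-- `γ` solves the interpolating sesqui-harmonic map equation `δ₂ τ₂(γ) - δ₁ τ(γ) = 0` on `J`. -/
def IsInterpolatingSesquiHarmonic (g : Metric E M) (δ₁ δ₂ : ℝ) (J : Set ℝ) (γ : ℝ → M) : Prop :=
  ∀ t ∈ J, δ₂ • bitension g γ t - δ₁ • tension g γ t = 0

/-- `γ` is a geodesic on `J`: `∇_T T = 0`. -/
def IsGeodesic (g : Metric E M) (J : Set ℝ) (γ : ℝ → M) : Prop :=
  ∀ t ∈ J, covDeriv g γ (velocity γ) t = 0

/-- `γ : J → M` is a smooth Frenet curve with Frenet frame `F 1, …, F r` and curvatures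
`k 1, …, k (r - 1)`: the `F i` are smooth orthonormal fields along `γ`, `F 1 = T`, the `k i` are
smooth nonnegative functions, and `∇_T F i = - k (i - 1) F (i - 1) + k i F (i + 1)`, where the first
term is absent for `i = 1` and the second one for `i = r`.
(The values of `F` and `k` at other indices are irrelevant.) -/
structure IsFrenetCurve (g : Metric E M) (J : Set ℝ) (γ : ℝ → M) (r : ℕ)
    (F : ℕ → ∀ t, TangentSpace 𝓘(ℝ, E) (γ t)) (k : ℕ → ℝ → ℝ) : Prop where
  one_le : 1 ≤ r
  smooth_curve : ContMDiffOn 𝓘(ℝ, ℝ) 𝓘(ℝ, E) ∞ γ J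
  smooth_frame : ∀ i ∈ Finset.Icc 1 r, ContMDiffOn 𝓘(ℝ, ℝ) (𝓘(ℝ, E).prod 𝓘(ℝ, E)) ∞
    (fun t => (⟨γ t, F i t⟩ : TangentBundle 𝓘(ℝ, E) M)) J
  smooth_curvature : ∀ i ∈ Finset.Ico 1 r, ContDiffOn ℝ ∞ (k i) J
  curvature_nonneg : ∀ i ∈ Finset.Ico 1 r, ∀ t ∈ J, 0 ≤ k i t
  orthonormal : ∀ t ∈ J, ∀ i ∈ Finset.Icc 1 r, ∀ j ∈ Finset.Icc 1 r,
    g.inner (γ t) (F i t) (F j t) = if i = j then 1 else 0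
  frame_one : ∀ t ∈ J, F 1 t = velocity γ t
  frenet : ∀ t ∈ J, ∀ i ∈ Finset.Icc 1 r, covDeriv g γ (F i) t =
    (if 1 < i then -(k (i - 1) t) • F (i - 1) t else 0)
      + (if i < r then k i t • F (i + 1) t else 0)

/-- `γ` is a helix on `J` with curvatures `κ₁` and `κ₂`: a Frenet curve of osculating order three
whose curvatures are the positive constants `κ₁`, `κ₂`. -/
def IsHelix (g : Metric E M) (J : Set ℝ) (γ : ℝ → M) (κ₁ κ₂ : ℝ) : Prop :=
  0 < κ₁ ∧ 0 < κ₂ ∧ ∃ F : ℕ → ∀ t, TangentSpace 𝓘(ℝ, E) (γ t),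
    IsFrenetCurve g J γ 3 F (fun i _ => if i = 1 then κ₁ else κ₂)

/-! ### Sasakian manifolds -/

/-- A (smooth) almost contact metric structure `(φ, ξ, η, g)` on `M`. -/
structure AlmostContactMetric (E : Type*) [NormedAddCommGroup E] [NormedSpace ℝ E]
    (M : Type*) [TopologicalSpace M] [ChartedSpace E M] [IsManifold 𝓘(ℝ, E) ∞ M] where
  φ : ∀ p : M, TangentSpace 𝓘(ℝ, E) p →L[ℝ] TangentSpace 𝓘(ℝ, E) p
  ξ : ∀ p : M, TangentSpace 𝓘(ℝ, E) p
  η : ∀ p : M, TangentSpace 𝓘(ℝ, E) p →L[ℝ] ℝ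
  g : Metric E M
  smooth_φ : ContMDiff 𝓘(ℝ, E) (𝓘(ℝ, E).prod 𝓘(ℝ, E →L[ℝ] E)) ∞
    (fun p => TotalSpace.mk' (E →L[ℝ] E)
      (E := fun p : M => TangentSpace 𝓘(ℝ, E) p →L[ℝ] TangentSpace 𝓘(ℝ, E) p) p (φ p))
  smooth_ξ : ContMDiff 𝓘(ℝ, E) (𝓘(ℝ, E).prod 𝓘(ℝ, E)) ∞
    (fun p => (⟨p, ξ p⟩ : TangentBundle 𝓘(ℝ, E) M))
  smooth_η : ContMDiff 𝓘(ℝ, E) (𝓘(ℝ, E).prod 𝓘(ℝ, E →L[ℝ] ℝ)) ∞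
    (fun p => TotalSpace.mk' (E →L[ℝ] ℝ)
      (E := fun p : M => TangentSpace 𝓘(ℝ, E) p →L[ℝ] ℝ) p (η p))
  φ_sq : ∀ (p : M) (X : TangentSpace 𝓘(ℝ, E) p), φ p (φ p X) = -X + η p X • ξ p
  η_ξ : ∀ p : M, η p (ξ p) = 1
  compatible : ∀ (p : M) (X Y : TangentSpace 𝓘(ℝ, E) p),
    g.inner p (φ p X) (φ p Y) = g.inner p X Y - η p X * η p Y

namespace AlmostContactMetric

/-- The coordinate expression of `φ` in the chart around `x₀`. -/
def φInChart (S : AlmostContactMetric E M) (x₀ : M) (y : E) : E →L[ℝ] E :=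
  let p := (extChartAt 𝓘(ℝ, E) x₀).symm y
  (toChart x₀ p) ∘L (S.φ p) ∘L (ofChart x₀ p)

/-- The coordinate expression of `ξ` in the chart around `x₀`. -/
def ξInChart (S : AlmostContactMetric E M) (x₀ : M) (y : E) : E :=
  let p := (extChartAt 𝓘(ℝ, E) x₀).symm y
  toChart x₀ p (S.ξ p)

/-- The coordinate expression of `η` in the chart around `x₀`. -/
def ηInChart (S : AlmostContactMetric E M) (x₀ : M) (y : E) : E →L[ℝ] ℝ :=
  let p := (extChartAt 𝓘(ℝ, E) x₀).symm y
  (S.η p) ∘L (ofChart x₀ p)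

/-- A Sasakian structure: a contact metric structure, `dη(X, Y) = g(X, φ Y)`, which is normal,
`N_φ = -2 dη ⊗ ξ`. Both tensor identities are written in the charts of `M`. -/
structure IsSasakian (S : AlmostContactMetric E M) : Prop where
  contact : ∀ (x₀ : M), ∀ y ∈ (extChartAt 𝓘(ℝ, E) x₀).target, ∀ u v : E,
    extDerivOneForm (S.ηInChart x₀) y u v
      = metricInChart S.g x₀ y u (S.φInChart x₀ y v)
  normal : ∀ (x₀ : M), ∀ y ∈ (extChartAt 𝓘(ℝ, E) x₀).target, ∀ u v : E,
    nijenhuis (S.φInChart x₀) y u v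
      = -(2 * extDerivOneForm (S.ηInChart x₀) y u v) • S.ξInChart x₀ y

/-- A Sasakian space form `M(c)`: a Sasakian manifold all of whose `φ`-sections, the planes spanned
by `X` and `φ X` for a unit vector `X` orthogonal to `ξ`, have sectional curvature `c`. -/
structure IsSasakianSpaceForm (S : AlmostContactMetric E M) (c : ℝ) : Prop where
  sasakian : S.IsSasakian
  phi_sectional : ∀ (p : M) (X : TangentSpace 𝓘(ℝ, E) p), S.η p X = 0 → S.g.inner p X X = 1 →
    S.g.inner p (riemann S.g p X (S.φ p X) (S.φ p X)) X = c

/-- `γ` is a Legendre curve on `J`: `η(T) = 0`. -/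
def IsLegendre (S : AlmostContactMetric E M) (J : Set ℝ) (γ : ℝ → M) : Prop :=
  ∀ t ∈ J, S.η (γ t) (velocity γ t) = 0

end AlmostContactMetric

end SasakianCurves

end

open SasakianCurves

/-! The argument rests on three identities valid on a Sasakian space form: `(∇_X φ)Y = g(X,Y)ξ -
η(Y)X`, `∇_X ξ = -φX`, and `R(T, φT)T = -c φT` for unit `T` orthogonal to `ξ`.

The first two determine the frame. Since `φT` is a unit vector parallel to `E₂`, continuity on the
interval gives `E₂ = ε φT` with a constant sign. Then `∇_T φT = φ(∇_T T) + ξ`, and comparing with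
the Frenet equation for `E₂` leaves `k₂ E₃ = ε ξ`; so `r ≥ 3`, `k₂ = 1` and `E₃ = ε ξ`.
Differentiating once more, `∇_T E₃ = -E₂`, which kills `k₃`. This is `exists_hasSasakianFrame`.

The third identity makes the curvature term of the bitension a multiple of `E₂`, so `τ₂` lies in the
span of `E₁, E₂, E₃` with coefficients in `k₁` and its derivatives (`bitension_eq`). The `E₃`
coefficient forces `k₁' = 0`, and the `E₂` coefficient becomes `k₁ (k₁² - (c - 1 - δ₁/δ₂)) = 0`.
Both claims follow from the sign of `c - 1 - δ₁/δ₂`.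

The definition of a Sasakian structure gives only `dη = Φ`, where `Φ(X,Y) = g(X, φY)`, and the value
of `N_φ`, so the identities are derived in coordinates. `inner_covDerivPhi` obtains `∇φ` by linear
elimination from closedness of `Φ`, normality and the derivative of `φ² = -I + η ⊗ ξ`; `curvature_φ`
is the resulting commutation rule between `R` and `φ`; `curvature_phi_phi` polarizes the sectional
curvature hypothesis. -/

noncomputable section

namespace SasakianCurves

open Set Filter Topology

set_option synthInstance.maxHeartbeats 400000

/-! ### Levi-Civita connection and curvature symmetries in coordinates. -/

section LocalGeometry

variable {E : Type*} [NormedAddCommGroup E] [NormedSpace ℝ E]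

/-- `G` is a smooth Riemannian metric on the open subset `U` of a vector space. -/
structure IsMetricOn (G : E → E →L[ℝ] E →L[ℝ] ℝ) (U : Set E) : Prop where
  isOpen : IsOpen U
  smooth : ContDiffOn ℝ ∞ G U
  symm : ∀ y ∈ U, ∀ u v, G y u v = G y v u
  pos : ∀ y ∈ U, ∀ u, u ≠ 0 → 0 < G y u u

instance : NormedAddCommGroup (E →L[ℝ] E →L[ℝ] ℝ) := inferInstance
instance : NormedSpace ℝ (E →L[ℝ] E →L[ℝ] ℝ) := inferInstance
instance : NormedAddCommGroup (E →L[ℝ] E →L[ℝ] E) := inferInstance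
instance : NormedSpace ℝ (E →L[ℝ] E →L[ℝ] E) := inferInstance

lemma fderiv_clm_apply_const {F H : Type*} [NormedAddCommGroup F] [NormedSpace ℝ F]
    [NormedAddCommGroup H] [NormedSpace ℝ H] {f : E → F →L[ℝ] H} {y : E}
    (hf : DifferentiableAt ℝ f y) (a : F) (u : E) :
    fderiv ℝ (fun z => f z a) y u = fderiv ℝ f y u a := by
  rw [(hf.hasFDerivAt.clm_apply (hasFDerivAt_const a y)).fderiv]
  simp

lemma fderiv_clm_apply_apply {F H : Type*} [NormedAddCommGroup F] [NormedSpace ℝ F]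
    [NormedAddCommGroup H] [NormedSpace ℝ H] {f : E → F →L[ℝ] H} {g : E → F} {y : E}
    (hf : DifferentiableAt ℝ f y) (hg : DifferentiableAt ℝ g y) (u : E) :
    fderiv ℝ (fun z => f z (g z)) y u = fderiv ℝ f y u (g y) + f y (fderiv ℝ g y u) := by
  rw [(hf.hasFDerivAt.clm_apply hg.hasFDerivAt).fderiv]
  simp [add_comm]

/-- The Christoffel symbol as a continuous bilinear map. -/
def christoffelCLM (G : E → E →L[ℝ] E →L[ℝ] ℝ) (y : E) : E →L[ℝ] E →L[ℝ] E :=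
  (ContinuousLinearMap.compL ℝ E (E →L[ℝ] ℝ) E (G y).inverse) ∘L
    ((1 / 2 : ℝ) • (fderiv ℝ G y + (fderiv ℝ G y).flip
      - (ContinuousLinearMap.flipₗᵢ ℝ E E ℝ : (E →L[ℝ] E →L[ℝ] ℝ) →L[ℝ] (E →L[ℝ] E →L[ℝ] ℝ))
        ∘L (fderiv ℝ G y).flip))

lemma christoffelCLM_apply (G : E → E →L[ℝ] E →L[ℝ] ℝ) (y u v : E) :
    christoffelCLM G y u v = christoffel G y u v := rfl

lemma fderiv_fderiv_comm {F : Type*} [NormedAddCommGroup F] [NormedSpace ℝ F] {f : E → F}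
    {U : Set E} (hU : IsOpen U) (hf : ContDiffOn ℝ ∞ f U) {y : E} (hy : y ∈ U) (u v : E) :
    fderiv ℝ (fderiv ℝ f) y u v = fderiv ℝ (fderiv ℝ f) y v u := by
  have h : ContDiffAt ℝ ∞ f y := hf.contDiffAt (hU.mem_nhds hy)
  exact (h.isSymmSndFDerivAt (by simpa using WithTop.coe_le_coe.2 (le_top : (2 : ℕ∞) ≤ ⊤))).eq u v

lemma contDiffOn_fderiv {F : Type*} [NormedAddCommGroup F] [NormedSpace ℝ F] {f : E → F}
    {U : Set E} (hU : IsOpen U) (hf : ContDiffOn ℝ ∞ f U) : ContDiffOn ℝ ∞ (fderiv ℝ f) U :=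
  hf.fderiv_of_isOpen hU (by simp)

lemma differentiableAt_of_contDiffOn {F : Type*} [NormedAddCommGroup F] [NormedSpace ℝ F]
    {f : E → F} {U : Set E} (hU : IsOpen U) (hf : ContDiffOn ℝ ∞ f U) {y : E} (hy : y ∈ U) :
    DifferentiableAt ℝ f y :=
  (hf.contDiffAt (hU.mem_nhds hy)).differentiableAt (by simp)

namespace IsMetricOn

variable {G : E → E →L[ℝ] E →L[ℝ] ℝ} {U : Set E} (hG : IsMetricOn G U)
include hG

lemma differentiableAt {y : E} (hy : y ∈ U) : DifferentiableAt ℝ G y :=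
  differentiableAt_of_contDiffOn hG.isOpen hG.smooth hy

lemma eq_of_inner_eq {y : E} (hy : y ∈ U) {u v : E} (h : ∀ w, G y u w = G y v w) : u = v := by
  by_contra hne
  have := hG.pos y hy (u - v) (sub_ne_zero.2 hne)
  rw [(G y).map_sub, sub_apply, (G y u).map_sub, (G y v).map_sub] at this
  simp [h] at this

/-- Positivity makes `G y` injective into the dual, which has the same finite dimension. This
ensures that the `inverse` in `christoffel` is a true inverse rather than its default value. -/
lemma isInvertible [FiniteDimensional ℝ E] {y : E} (hy : y ∈ U) : (G y).IsInvertible := by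
  have hinj : Function.Injective (G y : E →ₗ[ℝ] (E →L[ℝ] ℝ)) := by
    intro u v huv
    refine hG.eq_of_inner_eq hy fun w => ?_
    exact DFunLike.congr_fun huv w
  have hdim : Module.finrank ℝ E = Module.finrank ℝ (E →L[ℝ] ℝ) := by
    rw [← (LinearMap.toContinuousLinearMap (𝕜 := ℝ) (E := E) (F' := ℝ)).finrank_eq]
    exact (Subspace.dual_finrank_eq (K := ℝ) (V := E)).symm
  let e := (LinearEquiv.ofInjectiveOfFinrankEq _ hinj hdim).toContinuousLinearEquiv
  exact ⟨e, by ext; rfl⟩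

lemma inner_christoffel [FiniteDimensional ℝ E] {y : E} (hy : y ∈ U) (u v w : E) :
    G y (christoffelCLM G y u v) w
      = 1 / 2 * (fderiv ℝ G y u v w + fderiv ℝ G y v u w - fderiv ℝ G y w u v) := by
  rw [christoffelCLM_apply, christoffel, (hG.isInvertible hy).self_apply_inverse]
  simp

lemma fderiv_symm {y : E} (hy : y ∈ U) (u v w : E) :
    fderiv ℝ G y u v w = fderiv ℝ G y u w v := by
  have hd := hG.differentiableAt hy
  have h : (fun z => G z v w) =ᶠ[𝓝 y] fun z => G z w v := by
    filter_upwards [hG.isOpen.mem_nhds hy] with z hz using hG.symm z hz v w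
  have h1 := h.fderiv_eq (𝕜 := ℝ)
  have h2 : ∀ a b, fderiv ℝ (fun z => G z a b) y u = fderiv ℝ G y u a b := fun a b => by
    rw [fderiv_clm_apply_const (hd.clm_apply (differentiableAt_const a)),
      fderiv_clm_apply_const hd]
  rw [← h2, ← h2, h1]

lemma christoffel_symm [FiniteDimensional ℝ E] {y : E} (hy : y ∈ U) (u v : E) :
    christoffelCLM G y u v = christoffelCLM G y v u := by
  refine hG.eq_of_inner_eq hy fun w => ?_
  rw [hG.inner_christoffel hy, hG.inner_christoffel hy, hG.fderiv_symm hy w u v]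
  ring

/-- The Levi-Civita connection is metric. -/
lemma fderiv_apply [FiniteDimensional ℝ E] {y : E} (hy : y ∈ U) (u v w : E) :
    fderiv ℝ G y u v w
      = G y (christoffelCLM G y u v) w + G y v (christoffelCLM G y u w) := by
  rw [hG.symm y hy v, hG.inner_christoffel hy, hG.inner_christoffel hy, hG.fderiv_symm hy u w v,
    hG.fderiv_symm hy w u v, hG.fderiv_symm hy v u w]
  ring

lemma contDiffOn_christoffel [FiniteDimensional ℝ E] :
    ContDiffOn ℝ ∞ (christoffelCLM G) U := by
  have h1 : ContDiffOn ℝ ∞ (fun y => (G y).inverse) U := by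
    intro y hy
    obtain ⟨e, he⟩ := hG.isInvertible hy
    have h2 : ContDiffAt ℝ ∞ ContinuousLinearMap.inverse (G y) := by
      rw [← he]; exact contDiffAt_map_inverse e
    exact h2.comp_contDiffWithinAt y (hG.smooth y hy)
  have h3 : ∀ u v w, ContDiffOn ℝ ∞ (fun y => fderiv ℝ G y u v w) U := fun u v w =>
    (((contDiffOn_fderiv hG.isOpen hG.smooth).clm_apply contDiffOn_const).clm_apply
      contDiffOn_const).clm_apply contDiffOn_const
  refine contDiffOn_clm_apply.2 fun u => contDiffOn_clm_apply.2 fun v => ?_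
  refine h1.clm_apply (contDiffOn_clm_apply.2 fun w => ?_)
  exact contDiffOn_const.mul (((h3 u v w).add (h3 v u w)).sub (h3 w u v))

lemma differentiableAt_christoffel [FiniteDimensional ℝ E] {y : E} (hy : y ∈ U) :
    DifferentiableAt ℝ (christoffelCLM G) y :=
  differentiableAt_of_contDiffOn hG.isOpen hG.contDiffOn_christoffel hy

lemma curvature_eq [FiniteDimensional ℝ E] {y : E} (hy : y ∈ U) (u v w : E) :
    curvature G y u v w
      = fderiv ℝ (christoffelCLM G) y u v w - fderiv ℝ (christoffelCLM G) y v u w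
        + christoffelCLM G y u (christoffelCLM G y v w)
        - christoffelCLM G y v (christoffelCLM G y u w) := by
  have hd := hG.differentiableAt_christoffel hy
  have h : ∀ a b c, fderiv ℝ (fun z => christoffel G z a b) y c
      = fderiv ℝ (christoffelCLM G) y c a b := fun a b c => by
    simp only [← christoffelCLM_apply]
    rw [fderiv_clm_apply_const (hd.clm_apply (differentiableAt_const a)),
      fderiv_clm_apply_const hd]
  simp only [curvature, h, christoffelCLM_apply]

lemma curvature_antisymm [FiniteDimensional ℝ E] {y : E} (hy : y ∈ U) (u v w : E) :
    curvature G y u v w = -curvature G y v u w := by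
  rw [hG.curvature_eq hy, hG.curvature_eq hy]; abel

lemma fderiv_christoffel_symm [FiniteDimensional ℝ E] {y : E} (hy : y ∈ U) (u v w : E) :
    fderiv ℝ (christoffelCLM G) y u v w = fderiv ℝ (christoffelCLM G) y u w v := by
  have hd := hG.differentiableAt_christoffel hy
  have h : (fun z => christoffelCLM G z v w) =ᶠ[𝓝 y] fun z => christoffelCLM G z w v := by
    filter_upwards [hG.isOpen.mem_nhds hy] with z hz using hG.christoffel_symm hz v w
  have h1 := h.fderiv_eq (𝕜 := ℝ)
  have h2 : ∀ a b, fderiv ℝ (fun z => christoffelCLM G z a b) y u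
      = fderiv ℝ (christoffelCLM G) y u a b := fun a b => by
    rw [fderiv_clm_apply_const (hd.clm_apply (differentiableAt_const a)),
      fderiv_clm_apply_const hd]
  rw [← h2, ← h2, h1]

/-- The first Bianchi identity. -/
lemma curvature_bianchi [FiniteDimensional ℝ E] {y : E} (hy : y ∈ U) (u v w : E) :
    curvature G y u v w + curvature G y v w u + curvature G y w u v = 0 := by
  rw [hG.curvature_eq hy, hG.curvature_eq hy, hG.curvature_eq hy,
    hG.fderiv_christoffel_symm hy u w v, hG.fderiv_christoffel_symm hy v w u,
    hG.fderiv_christoffel_symm hy u v w, hG.fderiv_christoffel_symm hy w v u,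
    hG.christoffel_symm hy w v, hG.christoffel_symm hy w u, hG.christoffel_symm hy v u,
    hG.fderiv_christoffel_symm hy v u w]
  abel

/-- The second derivatives of `G` commute; expressing them through `∇G = 0` turns this symmetry into
skewness of the curvature operator. -/
lemma curvature_skew [FiniteDimensional ℝ E] {y : E} (hy : y ∈ U) (u v w z : E) :
    G y (curvature G y u v w) z = -G y (curvature G y u v z) w := by
  have hd := hG.differentiableAt hy
  have hΓ := hG.differentiableAt_christoffel hy
  have hD := differentiableAt_of_contDiffOn hG.isOpen (contDiffOn_fderiv hG.isOpen hG.smooth) hy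
  -- Metric compatibility holds on a neighbourhood of `y`, so it may be differentiated once more.
  have key : ∀ a b, fderiv ℝ (fderiv ℝ G) y a b w z
      = fderiv ℝ G y a (christoffelCLM G y b w) z + G y (fderiv ℝ (christoffelCLM G) y a b w) z
        + fderiv ℝ G y a w (christoffelCLM G y b z)
        + G y w (fderiv ℝ (christoffelCLM G) y a b z) := fun a b => by
    have c1 : ∀ x, DifferentiableAt ℝ (fun p => christoffelCLM G p b x) y := fun x =>
      (hΓ.clm_apply (differentiableAt_const b)).clm_apply (differentiableAt_const x)
    have c2 : ∀ x, fderiv ℝ (fun p => christoffelCLM G p b x) y a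
        = fderiv ℝ (christoffelCLM G) y a b x := fun x => by
      rw [fderiv_clm_apply_const (hΓ.clm_apply (differentiableAt_const b)),
        fderiv_clm_apply_const hΓ]
    have h3 : (fun x => fderiv ℝ G x b w z) =ᶠ[𝓝 y] fun x => G x (christoffelCLM G x b w) z
        + G x w (christoffelCLM G x b z) := by
      filter_upwards [hG.isOpen.mem_nhds hy] with x hx using hG.fderiv_apply hx b w z
    have h4 := DFunLike.congr_fun (h3.fderiv_eq (𝕜 := ℝ)) a
    have g1 := hd.clm_apply (c1 w)
    have g2 := hd.clm_apply (differentiableAt_const w)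
    rw [fderiv_clm_apply_const ((hD.clm_apply (differentiableAt_const b)).clm_apply
        (differentiableAt_const w)), fderiv_clm_apply_const (hD.clm_apply
        (differentiableAt_const b)), fderiv_clm_apply_const hD,
      fderiv_fun_add (g1.clm_apply (differentiableAt_const z)) (g2.clm_apply (c1 z)),
      add_apply, fderiv_clm_apply_const g1, fderiv_clm_apply_apply hd (c1 w),
      fderiv_clm_apply_apply g2 (c1 z), fderiv_clm_apply_const hd, c2, c2, add_apply] at h4
    rw [h4]
    ring
  have e1 := key u v
  have e2 := key v u
  rw [fderiv_fderiv_comm hG.isOpen hG.smooth hy, e2] at e1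
  simp only [hG.fderiv_apply hy] at e1
  rw [hG.curvature_eq hy, hG.curvature_eq hy]
  simp only [map_add, map_sub, add_apply, sub_apply]
  linarith [hG.symm y hy w (christoffelCLM G y u (christoffelCLM G y v z)),
    hG.symm y hy w (christoffelCLM G y v (christoffelCLM G y u z)),
    hG.symm y hy w (fderiv ℝ (christoffelCLM G) y u v z),
    hG.symm y hy w (fderiv ℝ (christoffelCLM G) y v u z)]

/-- The usual octahedron argument: four Bianchi sums combined with the two skew symmetries. -/
lemma curvature_pair_symm [FiniteDimensional ℝ E] {y : E} (hy : y ∈ U) (u v w z : E) :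
    G y (curvature G y u v w) z = G y (curvature G y w z u) v := by
  have b : ∀ p q r s, G y (curvature G y p q r) s + G y (curvature G y q r p) s
      + G y (curvature G y r p q) s = 0 := fun p q r s => by
    have := congrArg (fun x => G y x s) (hG.curvature_bianchi hy p q r)
    simpa using this
  have a : ∀ p q r s, G y (curvature G y p q r) s = -G y (curvature G y q p r) s :=
    fun p q r s => by rw [hG.curvature_antisymm hy p q r]; simp
  have s := hG.curvature_skew hy
  have b1 := b u v w z
  have b2 := b v w z u
  have b3 := b w z u v
  have b4 := b z u v w
  linarith [s u v w z, s v w u z, s w u v z, s v w z u, s w z v u, s z v w u, s w z u v, s z u w v,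
    s u w z v, s z u v w, s u v z w, s v z u w, a u v w z, a v w u z, a w u v z, a v w z u,
    a w z v u, a z v w u, a w z u v, a z u w v, a u w z v, a z u v w, a u v z w, a v z u w]

end IsMetricOn
end LocalGeometry

/-! ### Linear algebra of an almost contact metric structure at a point. -/

section AlmostContactAlgebra

variable {V : Type*} [AddCommGroup V] [Module ℝ V] [TopologicalSpace V]
  {φ : V →L[ℝ] V} {ξ : V} {η : V →L[ℝ] ℝ} {g : V →L[ℝ] V →L[ℝ] ℝ}

/-- From `φ²ξ = 0`, the formula for `φ²(φξ)` gives `φξ = aξ`; then `φ²ξ = a²ξ` forces `a = 0`. -/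
lemma phi_xi_eq_zero (hφ : ∀ X, φ (φ X) = -X + η X • ξ) (hη : η ξ = 1) : φ ξ = 0 := by
  have h0 : φ (φ ξ) = 0 := by rw [hφ, hη]; simp
  have h1 : φ ξ = η (φ ξ) • ξ := by
    have h := hφ (φ ξ)
    rw [h0, map_zero] at h
    exact (neg_add_eq_zero.1 h.symm)
  have h2 : η (φ ξ) * η (φ ξ) = 0 := by
    have h := congrArg η h0
    rw [h1, map_smul, h1] at h
    simpa [hη] using h
  rw [h1, mul_self_eq_zero.1 h2, zero_smul]

/-- Evaluate `φ³X` in two ways, as `φ²(φX)` and as `φ(φ²X)`. -/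
lemma eta_phi_eq_zero (hφ : ∀ X, φ (φ X) = -X + η X • ξ) (hη : η ξ = 1) (X : V) :
    η (φ X) = 0 := by
  have h := hφ (φ X)
  rw [hφ X, map_add, map_smul, phi_xi_eq_zero hφ hη, map_neg, smul_zero, add_zero] at h
  have h2 := congrArg η h
  simpa [hη] using h2

lemma inner_xi (hφ : ∀ X, φ (φ X) = -X + η X • ξ) (hη : η ξ = 1)
    (hg : ∀ X Y, g (φ X) (φ Y) = g X Y - η X * η Y) (X : V) : g X ξ = η X := by
  have h := hg X ξ
  rw [phi_xi_eq_zero hφ hη, map_zero, hη] at h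
  linarith

lemma inner_phi (hφ : ∀ X, φ (φ X) = -X + η X • ξ) (hη : η ξ = 1)
    (hg : ∀ X Y, g (φ X) (φ Y) = g X Y - η X * η Y) (hs : ∀ X Y, g X Y = g Y X) (X Y : V) :
    g (φ X) Y = -g X (φ Y) := by
  have h := hg (φ X) Y
  rw [hφ, eta_phi_eq_zero hφ hη, map_add, map_smul, map_neg] at h
  simp only [add_apply, neg_apply, smul_apply, smul_eq_mul] at h
  rw [hs ξ, inner_xi hφ hη hg, eta_phi_eq_zero hφ hη] at h
  linarith

end AlmostContactAlgebra

/-! ### First-order consequences of the Sasakian axioms in coordinates. -/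

section LocalSasakian

variable {E : Type*} [NormedAddCommGroup E] [NormedSpace ℝ E]

/-- `(φ, ξ, η, G)` is a Sasakian structure on the open subset `U` of a vector space. -/
structure IsSasakianOn (φ : E → E →L[ℝ] E) (ξ : E → E) (η : E → E →L[ℝ] ℝ)
    (G : E → E →L[ℝ] E →L[ℝ] ℝ) (U : Set E) : Prop extends IsMetricOn G U where
  smooth_φ : ContDiffOn ℝ ∞ φ U
  smooth_ξ : ContDiffOn ℝ ∞ ξ U
  smooth_η : ContDiffOn ℝ ∞ η U
  φ_sq : ∀ y ∈ U, ∀ u, φ y (φ y u) = -u + η y u • ξ y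
  η_ξ : ∀ y ∈ U, η y (ξ y) = 1
  compatible : ∀ y ∈ U, ∀ u v, G y (φ y u) (φ y v) = G y u v - η y u * η y v
  contact : ∀ y ∈ U, ∀ u v, extDerivOneForm η y u v = G y u (φ y v)
  normal : ∀ y ∈ U, ∀ u v, nijenhuis φ y u v = -(2 * extDerivOneForm η y u v) • ξ y

/-- The covariant derivative `(∇_u φ) v`. -/
def covDerivPhi (φ : E → E →L[ℝ] E) (G : E → E →L[ℝ] E →L[ℝ] ℝ) (y u v : E) : E :=
  fderiv ℝ φ y u v + christoffelCLM G y u (φ y v) - φ y (christoffelCLM G y u v)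

/-- The covariant derivative `(∇_u η) v`. -/
def covDerivEta (η : E → E →L[ℝ] ℝ) (G : E → E →L[ℝ] E →L[ℝ] ℝ) (y u v : E) : ℝ :=
  fderiv ℝ η y u v - η y (christoffelCLM G y u v)

namespace IsSasakianOn

variable {φ : E → E →L[ℝ] E} {ξ : E → E} {η : E → E →L[ℝ] ℝ} {G : E → E →L[ℝ] E →L[ℝ] ℝ}
  {U : Set E} (hS : IsSasakianOn φ ξ η G U)
include hS

lemma differentiableAt_φ {y : E} (hy : y ∈ U) : DifferentiableAt ℝ φ y :=
  differentiableAt_of_contDiffOn hS.isOpen hS.smooth_φ hy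

lemma differentiableAt_ξ {y : E} (hy : y ∈ U) : DifferentiableAt ℝ ξ y :=
  differentiableAt_of_contDiffOn hS.isOpen hS.smooth_ξ hy

lemma differentiableAt_η {y : E} (hy : y ∈ U) : DifferentiableAt ℝ η y :=
  differentiableAt_of_contDiffOn hS.isOpen hS.smooth_η hy

lemma φ_ξ {y : E} (hy : y ∈ U) : φ y (ξ y) = 0 :=
  phi_xi_eq_zero (hS.φ_sq y hy) (hS.η_ξ y hy)

lemma η_φ {y : E} (hy : y ∈ U) (u : E) : η y (φ y u) = 0 :=
  eta_phi_eq_zero (hS.φ_sq y hy) (hS.η_ξ y hy) u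

lemma inner_ξ {y : E} (hy : y ∈ U) (u : E) : G y u (ξ y) = η y u :=
  inner_xi (hS.φ_sq y hy) (hS.η_ξ y hy) (hS.compatible y hy) u

lemma inner_φ {y : E} (hy : y ∈ U) (u v : E) : G y (φ y u) v = -G y u (φ y v) :=
  inner_phi (hS.φ_sq y hy) (hS.η_ξ y hy) (hS.compatible y hy) (hS.symm y hy) u v

/-- The covariant derivative of `φ² = -I + η ⊗ ξ`, by the product rule. -/
lemma covDerivPhi_phi {y : E} (hy : y ∈ U) (u v : E) :
    covDerivPhi φ G y u (φ y v) + φ y (covDerivPhi φ G y u v)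
      = covDerivEta η G y u v • ξ y
        + η y v • (fderiv ℝ ξ y u + christoffelCLM G y u (ξ y)) := by
  have hd := hS.differentiableAt_φ hy
  have hη := hS.differentiableAt_η hy
  have hξ := hS.differentiableAt_ξ hy
  have h : (fun z => φ z (φ z v)) =ᶠ[𝓝 y] fun z => -v + η z v • ξ z := by
    filter_upwards [hS.isOpen.mem_nhds hy] with z hz using hS.φ_sq z hz v
  have h1 := DFunLike.congr_fun (h.fderiv_eq (𝕜 := ℝ)) u
  have hη' := hη.clm_apply (differentiableAt_const v)
  rw [fderiv_clm_apply_apply hd (hd.clm_apply (differentiableAt_const v)),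
    fderiv_clm_apply_const hd, fderiv_const_add, fderiv_fun_smul hη' hξ] at h1
  simp only [add_apply, smul_apply, ContinuousLinearMap.smulRight_apply,
    fderiv_clm_apply_const hη] at h1
  have h2 := hS.φ_sq y hy v
  have h3 := hS.φ_sq y hy (christoffelCLM G y u v)
  simp only [covDerivPhi, covDerivEta, h2, h3, map_add, map_sub, map_neg, map_smul]
  rw [eq_sub_of_add_eq h1]
  module

variable [FiniteDimensional ℝ E]

/-- As the connection is torsion-free, the antisymmetric part of `∇η` is `dη`, which the contact
condition identifies. -/
lemma covDerivEta_sub {y : E} (hy : y ∈ U) (u v : E) :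
    covDerivEta η G y u v - covDerivEta η G y v u = 2 * G y u (φ y v) := by
  have h := hS.contact y hy u v
  rw [extDerivOneForm] at h
  rw [← h, covDerivEta, covDerivEta, hS.christoffel_symm hy v u]
  ring

lemma inner_covDeriv_ξ {y : E} (hy : y ∈ U) (u v : E) :
    G y (fderiv ℝ ξ y u + christoffelCLM G y u (ξ y)) v = covDerivEta η G y u v := by
  have h : (fun z => G z v (ξ z)) =ᶠ[𝓝 y] fun z => η z v := by
    filter_upwards [hS.isOpen.mem_nhds hy] with z hz using hS.inner_ξ hz v
  have h1 := DFunLike.congr_fun (h.fderiv_eq (𝕜 := ℝ)) u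
  have hd := hS.differentiableAt hy
  rw [fderiv_clm_apply_const (hS.differentiableAt_η hy),
    fderiv_clm_apply_apply (hd.clm_apply (differentiableAt_const v)) (hS.differentiableAt_ξ hy),
    fderiv_clm_apply_const hd, hS.fderiv_apply hy, hS.inner_ξ hy] at h1
  rw [covDerivEta, ← h1, map_add, add_apply, hS.symm y hy v, hS.symm y hy v]
  ring

/-- `ξ` has constant length one, hence `∇_u ξ` is orthogonal to it. -/
lemma covDerivEta_ξ {y : E} (hy : y ∈ U) (u : E) : covDerivEta η G y u (ξ y) = 0 := by
  have h : (fun z => G z (ξ z) (ξ z)) =ᶠ[𝓝 y] fun z => (1 : ℝ) := by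
    filter_upwards [hS.isOpen.mem_nhds hy] with z hz
    rw [hS.inner_ξ hz, hS.η_ξ z hz]
  have h1 := DFunLike.congr_fun (h.fderiv_eq (𝕜 := ℝ)) u
  have hd := hS.differentiableAt hy
  have hξ := hS.differentiableAt_ξ hy
  rw [fderiv_clm_apply_apply (hd.clm_apply hξ) hξ, fderiv_clm_apply_apply hd hξ, add_apply,
    hS.fderiv_apply hy, hS.symm y hy (ξ y), hS.symm y hy (ξ y)] at h1
  rw [← hS.inner_covDeriv_ξ hy, map_add, add_apply]
  simp at h1
  linarith

lemma inner_covDerivPhi_phi {y : E} (hy : y ∈ U) (u v w : E) :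
    G y (covDerivPhi φ G y u (φ y v)) w - G y (covDerivPhi φ G y u v) (φ y w)
      = covDerivEta η G y u v * η y w + η y v * covDerivEta η G y u w := by
  have h := congrArg (fun x => G y x w) (hS.covDerivPhi_phi hy u v)
  simp only [(G y).map_add _ (η y v • _), (G y).map_smul (η y v), map_smul,
    add_apply, smul_apply, smul_eq_mul, hS.inner_covDeriv_ξ hy] at h
  rw [(G y).map_add, add_apply, hS.inner_φ hy, hS.symm y hy (ξ y), hS.inner_ξ hy] at h
  linarith

lemma inner_covDerivPhi_skew {y : E} (hy : y ∈ U) (u v w : E) :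
    G y (covDerivPhi φ G y u v) w = -G y (covDerivPhi φ G y u w) v := by
  have hd := hS.differentiableAt_φ hy
  have hG := hS.differentiableAt hy
  have h : (fun z => G z (φ z v) w) =ᶠ[𝓝 y] fun z => -G z v (φ z w) := by
    filter_upwards [hS.isOpen.mem_nhds hy] with z hz using hS.inner_φ hz v w
  have h1 := DFunLike.congr_fun (h.fderiv_eq (𝕜 := ℝ)) u
  have d1 := fun x => hd.clm_apply (differentiableAt_const x)
  rw [fderiv_clm_apply_const (hG.clm_apply (d1 v)), fderiv_clm_apply_apply hG (d1 v),
    fderiv_clm_apply_const hd, fderiv_fun_neg, neg_apply,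
    fderiv_clm_apply_apply (hG.clm_apply (differentiableAt_const v)) (d1 w),
    fderiv_clm_apply_const hG, fderiv_clm_apply_const hd, add_apply,
    hS.fderiv_apply hy, hS.fderiv_apply hy, hS.inner_φ hy,
    hS.symm y hy v, hS.symm y hy v] at h1
  simp only [covDerivPhi, map_add, map_sub, add_apply, sub_apply]
  linarith [hS.inner_φ hy (christoffelCLM G y u w) v, hS.inner_φ hy (christoffelCLM G y u v) w,
    hS.symm y hy v (fderiv ℝ φ y u w)]

/-- The fundamental two-form is closed. -/
lemma inner_covDerivPhi_cyclic {y : E} (hy : y ∈ U) (u v w : E) :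
    G y (covDerivPhi φ G y u v) w + G y (covDerivPhi φ G y v w) u
      + G y (covDerivPhi φ G y w u) v = 0 := by
  have hd := hS.differentiableAt_φ hy
  have hG := hS.differentiableAt hy
  have hD := differentiableAt_of_contDiffOn hS.isOpen (contDiffOn_fderiv hS.isOpen hS.smooth_η) hy
  -- Differentiating the contact condition expresses `∇Φ`, up to Christoffel terms, by second
  -- derivatives of `η`. In the cyclic sum these cancel because they commute, and the Christoffel
  -- terms cancel by symmetry.
  have key : ∀ a b c, G y c (covDerivPhi φ G y a b) + G y (christoffelCLM G y a c) (φ y b)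
      + G y c (φ y (christoffelCLM G y a b)) = 1 / 2 * (fderiv ℝ (fderiv ℝ η) y a c b
        - fderiv ℝ (fderiv ℝ η) y a b c) := fun a b c => by
    have h : (fun z => G z c (φ z b))
        =ᶠ[𝓝 y] fun z => (1 / 2 : ℝ) * (fderiv ℝ η z c b - fderiv ℝ η z b c) := by
      filter_upwards [hS.isOpen.mem_nhds hy] with z hz using (hS.contact z hz c b).symm
    have h1 := DFunLike.congr_fun (h.fderiv_eq (𝕜 := ℝ)) a
    have d1 := fun x => hD.clm_apply (differentiableAt_const x)
    have d2 := fun x x' => (d1 x).clm_apply (differentiableAt_const x')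
    have d3 := (d2 c b).fun_sub (d2 b c)
    rw [fderiv_clm_apply_apply (hG.clm_apply (differentiableAt_const c))
        (hd.clm_apply (differentiableAt_const b)), fderiv_clm_apply_const hG,
      fderiv_clm_apply_const hd, fderiv_const_mul d3, smul_apply,
      fderiv_fun_sub (d2 c b) (d2 b c), sub_apply, fderiv_clm_apply_const (d1 c),
      fderiv_clm_apply_const (d1 b), fderiv_clm_apply_const hD, fderiv_clm_apply_const hD,
      hS.fderiv_apply hy, smul_eq_mul] at h1
    rw [← h1]
    simp only [covDerivPhi, map_add, map_sub]
    ring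
  have k1 := key u v w
  have k2 := key v w u
  have k3 := key w u v
  have c : ∀ a b d, fderiv ℝ (fderiv ℝ η) y a b d = fderiv ℝ (fderiv ℝ η) y b a d :=
    fun a b d => by rw [fderiv_fderiv_comm hS.isOpen hS.smooth_η hy]
  rw [c u w v, c u v w] at k1
  rw [c v w u] at k2
  have s := hS.symm y hy
  have f := hS.inner_φ hy
  rw [s w] at k1; rw [s u] at k2; rw [s v] at k3
  rw [s _ (φ y v), f, hS.christoffel_symm hy u w] at k1
  rw [s _ (φ y w), f, hS.christoffel_symm hy v u] at k2
  rw [s _ (φ y u), f, hS.christoffel_symm hy w v] at k3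
  linarith

/-- Torsion-freeness lets covariant derivatives replace the brackets; the `φ²[u, v]` term vanishes
for constant fields. -/
lemma nijenhuis_eq {y : E} (hy : y ∈ U) (u v : E) :
    nijenhuis φ y u v = covDerivPhi φ G y (φ y u) v - covDerivPhi φ G y (φ y v) u
      + φ y (covDerivPhi φ G y v u) - φ y (covDerivPhi φ G y u v) := by
  have hd := hS.differentiableAt_φ hy
  have h : fderiv ℝ (fun _ : E => u) y = 0 ∧ fderiv ℝ (fun _ : E => v) y = 0 := by simp
  simp only [nijenhuis, VectorField.lieBracket, fderiv_clm_apply_const hd, h.1, h.2, covDerivPhi,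
    map_add, map_sub, zero_apply, map_zero, sub_zero, zero_sub, map_neg]
  rw [hS.christoffel_symm hy (φ y u) v, hS.christoffel_symm hy (φ y v) u,
    hS.christoffel_symm hy v u, hS.christoffel_symm hy (φ y v) (φ y u)]
  abel

/-- Normality paired with `w`, with the outer `φ` moved onto `w` by skewness. -/
lemma inner_covDerivPhi_normal {y : E} (hy : y ∈ U) (u v w : E) :
    G y (covDerivPhi φ G y (φ y u) v) w - G y (covDerivPhi φ G y (φ y v) u) w
      - G y (covDerivPhi φ G y v u) (φ y w) + G y (covDerivPhi φ G y u v) (φ y w)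
      = -(2 * G y u (φ y v)) * η y w := by
  have h := congrArg (fun x => G y x w) (hS.normal y hy u v)
  simp only [hS.nijenhuis_eq hy, hS.contact y hy, map_add, map_sub, map_smul, add_apply,
    sub_apply, smul_apply, hS.inner_φ hy, smul_eq_mul] at h
  rw [hS.symm y hy (ξ y), hS.inner_ξ hy] at h
  linarith

end IsSasakianOn
end LocalSasakian

/-! ### The tensor `∇φ` and the curvature of a Sasakian space form. -/

section LocalSasakianCurvature

variable {E : Type*} [NormedAddCommGroup E] [NormedSpace ℝ E]

namespace IsMetricOn

variable [FiniteDimensional ℝ E] {G : E → E →L[ℝ] E →L[ℝ] ℝ} {U : Set E} (hG : IsMetricOn G U)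
include hG

lemma curvature_add_fst {y : E} (hy : y ∈ U) (u u' v w : E) :
    curvature G y (u + u') v w = curvature G y u v w + curvature G y u' v w := by
  simp only [hG.curvature_eq hy, map_add, add_apply]; abel

lemma curvature_add_snd {y : E} (hy : y ∈ U) (u v v' w : E) :
    curvature G y u (v + v') w = curvature G y u v w + curvature G y u v' w := by
  simp only [hG.curvature_eq hy, map_add, add_apply]; abel

lemma curvature_add_thd {y : E} (hy : y ∈ U) (u v w w' : E) :
    curvature G y u v (w + w') = curvature G y u v w + curvature G y u v w' := by
  simp only [hG.curvature_eq hy, map_add]; abel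

lemma curvature_smul_fst {y : E} (hy : y ∈ U) (a : ℝ) (u v w : E) :
    curvature G y (a • u) v w = a • curvature G y u v w := by
  simp only [hG.curvature_eq hy, map_smul, smul_apply]; module

lemma curvature_smul_snd {y : E} (hy : y ∈ U) (a : ℝ) (u v w : E) :
    curvature G y u (a • v) w = a • curvature G y u v w := by
  simp only [hG.curvature_eq hy, map_smul, smul_apply]; module

lemma curvature_smul_thd {y : E} (hy : y ∈ U) (a : ℝ) (u v w : E) :
    curvature G y u v (a • w) = a • curvature G y u v w := by
  simp only [hG.curvature_eq hy, map_smul]; module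

end IsMetricOn

namespace IsSasakianOn

variable [FiniteDimensional ℝ E]
  {φ : E → E →L[ℝ] E} {ξ : E → E} {η : E → E →L[ℝ] ℝ} {G : E → E →L[ℝ] E →L[ℝ] ℝ}
  {U : Set E} (hS : IsSasakianOn φ ξ η G U)
include hS

/-- The analogue of the Koszul formula: the listed relations form a linear system in the components
of `∇φ` and `∇η` on `u, v, w` and their images under `φ`, and this system determines `∇φ`. -/
lemma inner_covDerivPhi {y : E} (hy : y ∈ U) (u v w : E) :
    G y (covDerivPhi φ G y u v) w = G y u v * η y w - η y v * G y u w := by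
  have hQξ := hS.covDerivEta_ξ hy
  have hφ := hS.φ_sq y hy
  have hηφ := hS.η_φ hy
  -- the `ξ`-component of `∇φ`
  have hξ : ∀ a b, G y (covDerivPhi φ G y a b) (ξ y) = -covDerivEta η G y a (φ y b) := by
    intro a b
    have h1 := hS.inner_covDerivPhi_phi hy a (φ y b) (ξ y)
    have h2 := hS.inner_covDerivPhi_skew hy a (ξ y) (ξ y)
    have h3 : covDerivPhi φ G y a (φ y (φ y b))
        = -covDerivPhi φ G y a b + η y b • covDerivPhi φ G y a (ξ y) := by
      simp only [covDerivPhi, hφ b, map_add, map_neg, map_smul]; module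
    rw [h3, hS.φ_ξ hy, hS.η_ξ y hy, hQξ, hηφ, map_zero, map_add, map_neg, map_smul, add_apply,
      neg_apply, smul_apply, smul_eq_mul] at h1
    have h4 : G y (covDerivPhi φ G y a (ξ y)) (ξ y) = 0 := by linarith
    rw [h4] at h1
    linarith
  have hQ := hS.covDerivEta_sub hy
  have hp : ∀ a b c, G y (covDerivPhi φ G y a b) (φ y (φ y c))
      = -G y (covDerivPhi φ G y a b) c - η y c * covDerivEta η G y a (φ y b) := by
    intro a b c
    rw [hφ c, map_add, map_neg, map_smul, smul_eq_mul, hξ]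
    ring
  -- Normality is tested against `φu` so that its last two terms return to `∇φ` on `u` through `φ²`.
  -- The closedness relation is needed both at `(u, v, w)` and at `(u, φv, φw)`.
  have e1 := hS.inner_covDerivPhi_normal hy v w (φ y u)
  rw [hp, hp, hηφ] at e1
  have e2 := hS.inner_covDerivPhi_phi hy (φ y v) w u
  have e3 := hS.inner_covDerivPhi_phi hy (φ y w) v u
  have e4 := hS.inner_covDerivPhi_phi hy u v (φ y w)
  rw [hp, hηφ] at e4
  have c1 := hS.inner_covDerivPhi_cyclic hy u v w
  have c2 := hS.inner_covDerivPhi_cyclic hy u (φ y v) (φ y w)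
  have k := hS.inner_covDerivPhi_skew hy
  have q1 := hQ (φ y v) w
  have q2 := hQ (φ y w) v
  have q3 := hQ u (φ y v)
  have q4 := hQ u (φ y w)
  rw [hφ, map_add, map_neg, map_smul, smul_eq_mul, hS.inner_ξ hy] at q3 q4
  have q5 : G y (φ y v) (φ y w) = G y (φ y w) (φ y v) := hS.symm y hy _ _
  have k1 := k w v u
  have k2 := k u (φ y v) (φ y w)
  have k3 := k (φ y w) u (φ y v)
  rw [q5] at q1
  -- The terms of `∇η` enter multiplied by values of `η`, so the contact relations are multiplied
  -- accordingly; what remains is linear.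
  have m1 := congrArg (fun x => x * η y u) q1
  have m2 := congrArg (fun x => x * η y u) q2
  have m3 := congrArg (fun x => x * η y w) q3
  have m4 := congrArg (fun x => x * η y v) q4
  linarith

/-- On a Sasakian manifold `(∇_u φ) v = g(u, v) ξ - η(v) u`. -/
lemma covDerivPhi_eq {y : E} (hy : y ∈ U) (u v : E) :
    covDerivPhi φ G y u v = G y u v • ξ y - η y v • u := by
  refine hS.eq_of_inner_eq hy fun w => ?_
  rw [hS.inner_covDerivPhi hy, map_sub, map_smul, map_smul, sub_apply, smul_apply, smul_apply,
    hS.symm y hy (ξ y), hS.inner_ξ hy, smul_eq_mul, smul_eq_mul]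

/-- On a Sasakian manifold `∇_u ξ = -φ u`. -/
lemma covDeriv_ξ {y : E} (hy : y ∈ U) (u : E) :
    fderiv ℝ ξ y u + christoffelCLM G y u (ξ y) = -φ y u := by
  have h : (fun z => φ z (ξ z)) =ᶠ[𝓝 y] fun _ => (0 : E) := by
    filter_upwards [hS.isOpen.mem_nhds hy] with z hz using hS.φ_ξ hz
  have h1 := DFunLike.congr_fun (h.fderiv_eq (𝕜 := ℝ)) u
  rw [fderiv_clm_apply_apply (hS.differentiableAt_φ hy) (hS.differentiableAt_ξ hy),
    fderiv_fun_const] at h1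
  have h2 := hS.covDerivPhi_eq hy u (ξ y)
  rw [hS.η_ξ y hy, hS.inner_ξ hy, covDerivPhi, hS.φ_ξ hy, map_zero, add_zero] at h2
  -- The formula for `∇φ` at `ξ`, with `φξ = 0`, determines `φ(∇_u ξ)`. Since `∇_u ξ` is orthogonal
  -- to `ξ`, applying `φ` again recovers it.
  have h3 : φ y (fderiv ℝ ξ y u + christoffelCLM G y u (ξ y)) = u - η y u • ξ y := by
    rw [map_add]
    have h4 : fderiv ℝ φ y u (ξ y) = -φ y (fderiv ℝ ξ y u) := eq_neg_of_add_eq_zero_left h1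
    rw [h4] at h2
    rw [one_smul] at h2
    rw [← neg_inj, neg_add, neg_sub, ← h2]
    abel
  have h5 : η y (fderiv ℝ ξ y u + christoffelCLM G y u (ξ y)) = 0 := by
    rw [← hS.inner_ξ hy, hS.inner_covDeriv_ξ hy, hS.covDerivEta_ξ hy]
  have h6 := congrArg (φ y) h3
  rw [hS.φ_sq y hy, h5, zero_smul, add_zero, map_sub, map_smul, hS.φ_ξ hy, smul_zero,
    sub_zero] at h6
  rw [← h6, neg_neg]

lemma covDerivEta_eq {y : E} (hy : y ∈ U) (u v : E) :
    covDerivEta η G y u v = -G y (φ y u) v := by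
  rw [← hS.inner_covDeriv_ξ hy, hS.covDeriv_ξ hy, map_neg, neg_apply]

lemma fderiv_φ {y : E} (hy : y ∈ U) (u v : E) :
    fderiv ℝ φ y u v = φ y (christoffelCLM G y u v) - christoffelCLM G y u (φ y v)
      + G y u v • ξ y - η y v • u := by
  have h := hS.covDerivPhi_eq hy u v
  rw [covDerivPhi] at h
  rw [add_sub_assoc, ← h]
  abel

/-- The Ricci identity for `φ`: differentiate the formula for `∇φ` and antisymmetrize. The extra
terms come from `∇ξ = -φ` and the corresponding `∇η`. -/
lemma curvature_φ {y : E} (hy : y ∈ U) (u v w : E) :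
    curvature G y u v (φ y w) = φ y (curvature G y u v w) - G y v w • φ y u + G y u w • φ y v
      + G y (φ y u) w • v - G y (φ y v) w • u := by
  have hd := hS.differentiableAt hy
  have hΓ := hS.differentiableAt_christoffel hy
  have hφ := hS.differentiableAt_φ hy
  have hξ := hS.differentiableAt_ξ hy
  have hη := hS.differentiableAt_η hy
  have hD := differentiableAt_of_contDiffOn hS.isOpen (contDiffOn_fderiv hS.isOpen hS.smooth_φ) hy
  have key : ∀ a b, fderiv ℝ (fderiv ℝ φ) y a b w
      = (fderiv ℝ φ y a (christoffelCLM G y b w) + φ y (fderiv ℝ (christoffelCLM G) y a b w))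
        - (fderiv ℝ (christoffelCLM G) y a b (φ y w)
          + christoffelCLM G y b (fderiv ℝ φ y a w))
        + (G y b w • fderiv ℝ ξ y a + fderiv ℝ G y a b w • ξ y)
        - fderiv ℝ η y a w • b := fun a b => by
    have h : (fun z => fderiv ℝ φ z b w) =ᶠ[𝓝 y] fun z => φ z (christoffelCLM G z b w)
        - christoffelCLM G z b (φ z w) + G z b w • ξ z - η z w • b := by
      filter_upwards [hS.isOpen.mem_nhds hy] with z hz using hS.fderiv_φ hz b w
    have h1 := DFunLike.congr_fun (h.fderiv_eq (𝕜 := ℝ)) a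
    have c1 := hΓ.clm_apply (differentiableAt_const b)
    have c2 := c1.clm_apply (differentiableAt_const w)
    have c3 := hφ.clm_apply (differentiableAt_const w)
    have c4 := hd.clm_apply (differentiableAt_const b)
    have c5 := c4.clm_apply (differentiableAt_const w)
    have c6 := hη.clm_apply (differentiableAt_const w)
    rw [fderiv_clm_apply_const (hD.clm_apply (differentiableAt_const b)),
      fderiv_clm_apply_const hD,
      fderiv_fun_sub ((((hφ.clm_apply c2).fun_sub (c1.clm_apply c3))).fun_add (c5.fun_smul hξ))
        (c6.fun_smul (differentiableAt_const b)),
      fderiv_fun_add ((hφ.clm_apply c2).fun_sub (c1.clm_apply c3)) (c5.fun_smul hξ),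
      fderiv_fun_sub (hφ.clm_apply c2) (c1.clm_apply c3), sub_apply, add_apply, sub_apply,
      fderiv_clm_apply_apply hφ c2, fderiv_clm_apply_apply c1 c3, fderiv_clm_apply_const c1,
      fderiv_clm_apply_const hΓ, fderiv_clm_apply_const hφ, fderiv_fun_smul c5 hξ,
      fderiv_fun_smul c6 (differentiableAt_const b), fderiv_fun_const] at h1
    rw [h1]
    simp [fderiv_clm_apply_const c4, fderiv_clm_apply_const hd, fderiv_clm_apply_const hη]
  have e1 := key u v
  rw [fderiv_fderiv_comm hS.isOpen hS.smooth_φ hy, key v u] at e1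
  have hDη : ∀ a b, fderiv ℝ η y a b = -G y (φ y a) b + η y (christoffelCLM G y a b) :=
    fun a b => by rw [← hS.covDerivEta_eq hy, covDerivEta]; ring
  have hDξ : ∀ a, fderiv ℝ ξ y a = -φ y a - christoffelCLM G y a (ξ y) :=
    fun a => eq_sub_of_add_eq (hS.covDeriv_ξ hy a)
  rw [hS.curvature_eq hy, hS.curvature_eq hy]
  simp only [hS.fderiv_φ hy, hDη, hDξ, hS.fderiv_apply hy, map_add, map_sub, map_smul] at e1 ⊢
  rw [hS.christoffel_symm hy v u] at e1
  rw [← sub_eq_zero] at e1 ⊢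
  rw [← e1]
  module

section PhiSectional

variable {c : ℝ} {y : E} (hy : y ∈ U)
  (hc : ∀ X, η y X = 0 → G y X X = 1 → G y (curvature G y X (φ y X) (φ y X)) X = c)
include hy hc

/-- Both sides are homogeneous of degree four, so unit vectors suffice. -/
lemma inner_curvature_phi_section (X : E) (hX : η y X = 0) :
    G y (curvature G y X (φ y X) (φ y X)) X = c * (G y X X) ^ 2 := by
  by_cases h0 : X = 0
  · subst h0; simp
  have hpos := hS.pos y hy X h0
  have hs : √(G y X X) ^ 2 = G y X X := Real.sq_sqrt hpos.le
  have hne : √(G y X X) ≠ 0 := (Real.sqrt_pos.2 hpos).ne'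
  set s := √(G y X X) with hsdef
  have h := hc (s⁻¹ • X) (by simp [hX]) (by
    simp only [map_smul, smul_apply, smul_eq_mul, ← hs]; field_simp)
  simp only [map_smul, smul_apply, smul_eq_mul, hS.curvature_smul_fst hy,
    hS.curvature_smul_snd hy, hS.curvature_smul_thd hy] at h
  rw [← hs, ← h]
  field_simp

/-- Polarization: the sectional hypothesis fixes only the `T`-component, but applied to `T + sW` its
first-order term in `s` shows that the components orthogonal to `T` and `ξ` vanish. -/
lemma curvature_phi_phi {T : E} (hη : η y T = 0) (hT : G y T T = 1) :
    curvature G y T (φ y T) (φ y T) = c • T := by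
  have hφT : φ y (φ y T) = -T := by rw [hS.φ_sq y hy, hη]; simp
  have hTT : G y (φ y T) T = 0 := by
    have := hS.inner_φ hy T T
    rw [hS.symm y hy T] at this
    linarith
  have hTT' : G y T (φ y T) = 0 := by rw [hS.symm y hy, hTT]
  have hTφ : G y (φ y T) (φ y T) = 1 := by rw [hS.compatible y hy, hη, hT]; ring
  have hξ : G y (curvature G y T (φ y T) (φ y T)) (ξ y) = 0 := by
    rw [hS.inner_ξ hy, hS.curvature_φ hy, hφT, hTT, hT]
    simp [hS.η_φ hy, hT]
  have hW : ∀ W, η y W = 0 → G y T W = 0 →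
      G y (curvature G y T (φ y T) (φ y T)) W = 0 := by
    intro W hW hTW
    have hWT : G y W T = 0 := by rw [hS.symm y hy, hTW]
    have f : ∀ s : ℝ, _ := fun s => hS.inner_curvature_phi_section hy hc (T + s • W)
      (by rw [map_add, map_smul, hη, hW]; simp)
    simp only [map_smul, map_add, add_apply, smul_apply, smul_eq_mul, hS.curvature_smul_fst hy,
      hS.curvature_smul_snd hy, hS.curvature_smul_thd hy, hS.curvature_add_fst hy,
      hS.curvature_add_snd hy, hS.curvature_add_thd hy, hTW, hWT, hT] at f
    -- For `W ⟂ T`, the right side `c(1 + s²|W|²)²` is even in `s`. The odd part of the left side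
    -- has coefficients only at `s` and `s³`, so the values at `±1` and `±2` isolate the linear one.
    have f1 := f 1
    have f2 := f (-1)
    have f3 := f 2
    have f4 := f (-2)
    have r1 := hS.curvature_pair_symm hy W (φ y T) (φ y T) T
    have r2 := hS.curvature_pair_symm hy T (φ y W) (φ y T) T
    -- With pair symmetry, this makes all four terms of the linear coefficient equal to `g(R(T,
    -- φT)φT, W)`.
    have r3 : G y (curvature G y T (φ y T) (φ y W)) T
        = G y (curvature G y T (φ y T) (φ y T)) W := by
      rw [hS.curvature_φ hy]
      simp only [map_add, map_sub, map_smul, add_apply, sub_apply, smul_apply, smul_eq_mul,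
        hφT, hTW, hTT, hT, map_neg, neg_apply, hS.inner_φ hy (curvature G y T (φ y T) W),
        hS.curvature_skew hy T (φ y T) W]
      ring
    have a1 : ∀ p q r s, G y (curvature G y p q r) s = -G y (curvature G y q p r) s :=
      fun p q r s => by rw [hS.curvature_antisymm hy p q r]; simp
    have a2 := hS.curvature_skew hy
    have r1' : G y (curvature G y W (φ y T) (φ y T)) T
        = G y (curvature G y T (φ y T) (φ y T)) W := by
      rw [r1, a1, a2, neg_neg]
    have r2' : G y (curvature G y T (φ y W) (φ y T)) T
        = G y (curvature G y T (φ y T) (φ y W)) T := by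
      rw [r2, a1, a2, neg_neg]
    rw [r1', r2', r3] at f1 f2 f3 f4
    linarith
  refine hS.eq_of_inner_eq hy fun w => ?_
  have hdec : w = G y T w • T + η y w • ξ y + (w - G y T w • T - η y w • ξ y) := by abel
  have h0 := hW (w - G y T w • T - η y w • ξ y)
    (by simp [hη, hS.η_ξ y hy]) (by simp [hT, hS.inner_ξ hy, hη])
  have hcT := hc T hη hT
  rw [map_sub, map_sub, map_smul, map_smul, hcT, hξ] at h0
  simp only [map_smul, smul_apply, smul_eq_mul] at h0 ⊢
  linarith

/-- In a Sasakian manifold of constant `φ`-sectional curvature `c`, `R(T, φT)T = -c φT` for unit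
vectors `T` orthogonal to `ξ`. -/
lemma curvature_phi_self {T : E} (hη : η y T = 0) (hT : G y T T = 1) :
    curvature G y T (φ y T) T = -c • φ y T := by
  have h := hS.curvature_phi_phi hy hc hη hT
  have hφT : φ y (φ y T) = -T := by rw [hS.φ_sq y hy, hη]; simp
  have hTT : G y (φ y T) T = 0 := by
    have := hS.inner_φ hy T T
    rw [hS.symm y hy T] at this
    linarith
  -- Needed for the `ξ`-component of `R(T, φT)T`, which `φ` cannot see: skewness reduces it to
  -- `g(R(T, φT)ξ, T)`.
  have hξ : φ y (curvature G y T (φ y T) (ξ y)) = 0 := by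
    have h1 := hS.curvature_φ hy T (φ y T) (ξ y)
    have hz : curvature G y T (φ y T) 0 = 0 := by
      simpa using hS.curvature_smul_thd hy 0 T (φ y T) 0
    rw [hS.φ_ξ hy, hS.inner_ξ hy, hS.inner_ξ hy, hS.inner_ξ hy, hφT, map_neg,
      hη, hS.η_φ hy, hz] at h1
    simpa using h1.symm
  have hξT : G y (curvature G y T (φ y T) (ξ y)) T = 0 := by
    have h2 := congrArg (fun x => G y x (φ y T)) hξ
    simp only [map_zero, zero_apply] at h2
    rw [hS.compatible y hy, hη] at h2
    linarith
  rw [hS.curvature_φ hy, hφT, hTT, hT, map_neg, neg_apply, hT] at h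
  have h2 := congrArg (φ y) (show φ y (curvature G y T (φ y T) T) = c • T by
    rw [← h]; module)
  rw [hS.φ_sq y hy, ← hS.inner_ξ hy, hS.curvature_skew hy, hξT, map_smul] at h2
  rw [neg_smul, ← h2]
  simp

end PhiSectional

end IsSasakianOn
end LocalSasakianCurvature

/-! ### Smoothness and structure equations of the chart expressions. -/

section ChartExpressions

variable {E : Type*} [NormedAddCommGroup E] [NormedSpace ℝ E]
  {M : Type*} [TopologicalSpace M] [ChartedSpace E M] [IsManifold 𝓘(ℝ, E) ∞ M]

lemma ofChart_toChart {x₀ p : M} (hp : p ∈ (extChartAt 𝓘(ℝ, E) x₀).source)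
    (v : TangentSpace 𝓘(ℝ, E) p) : ofChart x₀ p (toChart x₀ p v) = v :=
  (trivializationAt E (TangentSpace 𝓘(ℝ, E)) x₀).symmL_continuousLinearMapAt
    (by simpa using hp) v

lemma toChart_ofChart {x₀ p : M} (hp : p ∈ (extChartAt 𝓘(ℝ, E) x₀).source) (u : E) :
    toChart x₀ p (ofChart x₀ p u) = u :=
  (trivializationAt E (TangentSpace 𝓘(ℝ, E)) x₀).continuousLinearMapAt_symmL
    (by simpa using hp) u

lemma toChart_apply {x₀ p : M} (hp : p ∈ (extChartAt 𝓘(ℝ, E) x₀).source)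
    (v : TangentSpace 𝓘(ℝ, E) p) :
    toChart x₀ p v
      = (trivializationAt E (TangentSpace 𝓘(ℝ, E)) x₀ (⟨p, v⟩ : TangentBundle 𝓘(ℝ, E) M)).2 := by
  have hb : p ∈ (trivializationAt E (TangentSpace 𝓘(ℝ, E)) x₀).baseSet := by simpa using hp
  exact congrFun ((trivializationAt E (TangentSpace 𝓘(ℝ, E)) x₀).coe_linearMapAt_of_mem
    (R := ℝ) hb) v

lemma contMDiffOn_toChart (x₀ : M) {V : ∀ p : M, TangentSpace 𝓘(ℝ, E) p}
    (hV : ContMDiffOn 𝓘(ℝ, E) (𝓘(ℝ, E).prod 𝓘(ℝ, E)) ∞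
      (fun p => (⟨p, V p⟩ : TangentBundle 𝓘(ℝ, E) M)) (extChartAt 𝓘(ℝ, E) x₀).source) :
    ContMDiffOn 𝓘(ℝ, E) 𝓘(ℝ, E) ∞ (fun p => toChart x₀ p (V p))
      (extChartAt 𝓘(ℝ, E) x₀).source := by
  have h := ((trivializationAt E (TangentSpace 𝓘(ℝ, E)) x₀).contMDiffOn_section_iff
    (isOpen_extChartAt_source x₀) (by simp)).1 hV
  exact h.congr fun p hp => toChart_apply hp _

lemma contMDiffOn_ofChart (x₀ : M) (u : E) :
    ContMDiffOn 𝓘(ℝ, E) (𝓘(ℝ, E).prod 𝓘(ℝ, E)) ∞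
      (fun p => (⟨p, ofChart x₀ p u⟩ : TangentBundle 𝓘(ℝ, E) M))
      (extChartAt 𝓘(ℝ, E) x₀).source := by
  refine ((trivializationAt E (TangentSpace 𝓘(ℝ, E)) x₀).contMDiffOn_section_iff
    (isOpen_extChartAt_source x₀) (by simp)).2 ?_
  refine (contMDiffOn_const (c := u)).congr fun p hp => ?_
  rw [← toChart_apply hp, toChart_ofChart hp]

lemma contDiffOn_comp_extChartAt_symm {F : Type*} [NormedAddCommGroup F] [NormedSpace ℝ F]
    (x₀ : M) {f : M → F}
    (hf : ContMDiffOn 𝓘(ℝ, E) 𝓘(ℝ, F) ∞ f (extChartAt 𝓘(ℝ, E) x₀).source) :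
    ContDiffOn ℝ ∞ (fun y => f ((extChartAt 𝓘(ℝ, E) x₀).symm y))
      (extChartAt 𝓘(ℝ, E) x₀).target :=
  contMDiffOn_iff_contDiffOn.1 (hf.comp (contMDiffOn_extChartAt_symm x₀)
    fun _ hy => (extChartAt 𝓘(ℝ, E) x₀).map_target hy)

omit [IsManifold 𝓘(ℝ, E) ∞ M] in
lemma contMDiffOn_of_trivial_section {f : M → ℝ} {s : Set M}
    (hf : ContMDiffOn 𝓘(ℝ, E) (𝓘(ℝ, E).prod 𝓘(ℝ, ℝ)) ∞
      (fun p => TotalSpace.mk' ℝ (E := Bundle.Trivial M ℝ) p (f p)) s) :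
    ContMDiffOn 𝓘(ℝ, E) 𝓘(ℝ, ℝ) ∞ f s := fun p hp => by
  have h := hf p hp
  simp only [contMDiffWithinAt_totalSpace] at h
  exact h.2

variable [FiniteDimensional ℝ E]

lemma isMetricOn_metricInChart (g : Metric E M) (x₀ : M) :
    IsMetricOn (metricInChart g x₀) (extChartAt 𝓘(ℝ, E) x₀).target where
  isOpen := isOpen_extChartAt_target x₀
  smooth := by
    refine contDiffOn_clm_apply.2 fun u => contDiffOn_clm_apply.2 fun v => ?_
    refine contDiffOn_comp_extChartAt_symm x₀
      (f := fun p => g.inner p (ofChart x₀ p u) (ofChart x₀ p v)) ?_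
    refine contMDiffOn_of_trivial_section ?_
    exact ContMDiffOn.clm_bundle_apply₂ (F₁ := E) (F₂ := E)
      g.contMDiff.contMDiffOn (contMDiffOn_ofChart x₀ u) (contMDiffOn_ofChart x₀ v)
  symm y _ u v := g.symm _ _ _
  pos y hy u hu := by
    refine g.pos _ _ fun h => hu ?_
    rw [← toChart_ofChart ((extChartAt 𝓘(ℝ, E) x₀).map_target hy) u]
    exact (congrArg (toChart x₀ _) h).trans (map_zero _)

namespace AlmostContactMetric

variable {S : AlmostContactMetric E M}

lemma IsSasakian.isSasakianOn (hS : S.IsSasakian) (x₀ : M) :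
    IsSasakianOn (S.φInChart x₀) (S.ξInChart x₀) (S.ηInChart x₀) (metricInChart S.g x₀)
      (extChartAt 𝓘(ℝ, E) x₀).target where
  toIsMetricOn := isMetricOn_metricInChart S.g x₀
  smooth_φ := by
    refine contDiffOn_clm_apply.2 fun u => ?_
    refine contDiffOn_comp_extChartAt_symm x₀
      (f := fun p => toChart x₀ p (S.φ p (ofChart x₀ p u))) ?_
    refine contMDiffOn_toChart x₀ ?_
    exact ContMDiffOn.clm_bundle_apply (F₁ := E) (F₂ := E)
      S.smooth_φ.contMDiffOn (contMDiffOn_ofChart x₀ u)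
  smooth_ξ := contDiffOn_comp_extChartAt_symm x₀ (contMDiffOn_toChart x₀ S.smooth_ξ.contMDiffOn)
  smooth_η := by
    refine contDiffOn_clm_apply.2 fun u => ?_
    refine contDiffOn_comp_extChartAt_symm x₀ (f := fun p => S.η p (ofChart x₀ p u)) ?_
    refine contMDiffOn_of_trivial_section ?_
    exact ContMDiffOn.clm_bundle_apply (F₁ := E) (F₂ := ℝ)
      S.smooth_η.contMDiffOn (contMDiffOn_ofChart x₀ u)
  φ_sq y hy u := by
    have hp := (extChartAt 𝓘(ℝ, E) x₀).map_target hy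
    simp only [φInChart, ηInChart, ξInChart, ContinuousLinearMap.comp_apply,
      ofChart_toChart hp, S.φ_sq, map_add, map_neg, map_smul, toChart_ofChart hp]
  η_ξ y hy := by
    have hp := (extChartAt 𝓘(ℝ, E) x₀).map_target hy
    simp only [ηInChart, ξInChart, ContinuousLinearMap.comp_apply, ofChart_toChart hp, S.η_ξ]
  compatible y hy u v := by
    have hp := (extChartAt 𝓘(ℝ, E) x₀).map_target hy
    change S.g.inner _ (ofChart x₀ _ (toChart x₀ _ _)) (ofChart x₀ _ (toChart x₀ _ _)) = _
    rw [ofChart_toChart hp, ofChart_toChart hp]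
    exact S.compatible _ _ _
  contact := hS.contact x₀
  normal := hS.normal x₀

end AlmostContactMetric

end ChartExpressions

/-! ### Tensors at a point compared with their chart expressions. -/

section Pointwise

variable {E : Type*} [NormedAddCommGroup E] [NormedSpace ℝ E]
  {M : Type*} [TopologicalSpace M] [ChartedSpace E M] [IsManifold 𝓘(ℝ, E) ∞ M]

lemma metricInChart_apply (g : Metric E M) {x₀ q : M}
    (hq : q ∈ (extChartAt 𝓘(ℝ, E) x₀).source) (X Y : TangentSpace 𝓘(ℝ, E) q) :
    metricInChart g x₀ (extChartAt 𝓘(ℝ, E) x₀ q) (toChart x₀ q X) (toChart x₀ q Y)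
      = g.inner q X Y := by
  -- The fibre depends on the point `symm y`; a free coordinate `y` allows `q` to be substituted
  -- without transport between fibres.
  have h : ∀ y, (extChartAt 𝓘(ℝ, E) x₀).symm y = q → ∀ u v, metricInChart g x₀ y u v
      = g.inner q (ofChart x₀ q u) (ofChart x₀ q v) := by
    rintro y rfl u v; rfl
  rw [h _ ((extChartAt 𝓘(ℝ, E) x₀).left_inv hq), ofChart_toChart hq, ofChart_toChart hq]

namespace AlmostContactMetric

variable (S : AlmostContactMetric E M)

lemma φInChart_apply {x₀ q : M} (hq : q ∈ (extChartAt 𝓘(ℝ, E) x₀).source)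
    (X : TangentSpace 𝓘(ℝ, E) q) :
    S.φInChart x₀ (extChartAt 𝓘(ℝ, E) x₀ q) (toChart x₀ q X) = toChart x₀ q (S.φ q X) := by
  have h : ∀ y, (extChartAt 𝓘(ℝ, E) x₀).symm y = q → ∀ u, S.φInChart x₀ y u
      = toChart x₀ q (S.φ q (ofChart x₀ q u)) := by
    rintro y rfl u; rfl
  rw [h _ ((extChartAt 𝓘(ℝ, E) x₀).left_inv hq), ofChart_toChart hq]

lemma ξInChart_apply {x₀ q : M} (hq : q ∈ (extChartAt 𝓘(ℝ, E) x₀).source) :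
    S.ξInChart x₀ (extChartAt 𝓘(ℝ, E) x₀ q) = toChart x₀ q (S.ξ q) := by
  have h : ∀ y, (extChartAt 𝓘(ℝ, E) x₀).symm y = q → S.ξInChart x₀ y
      = toChart x₀ q (S.ξ q) := by
    rintro y rfl; rfl
  exact h _ ((extChartAt 𝓘(ℝ, E) x₀).left_inv hq)

lemma ηInChart_apply {x₀ q : M} (hq : q ∈ (extChartAt 𝓘(ℝ, E) x₀).source)
    (X : TangentSpace 𝓘(ℝ, E) q) :
    S.ηInChart x₀ (extChartAt 𝓘(ℝ, E) x₀ q) (toChart x₀ q X) = S.η q X := by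
  have h : ∀ y, (extChartAt 𝓘(ℝ, E) x₀).symm y = q → ∀ u, S.ηInChart x₀ y u
      = S.η q (ofChart x₀ q u) := by
    rintro y rfl u; rfl
  rw [h _ ((extChartAt 𝓘(ℝ, E) x₀).left_inv hq), ofChart_toChart hq]

end AlmostContactMetric

variable [FiniteDimensional ℝ E]

lemma AlmostContactMetric.IsSasakianSpaceForm.riemann_phi_self {S : AlmostContactMetric E M}
    {c : ℝ} (hS : S.IsSasakianSpaceForm c) {p : M} {T : TangentSpace 𝓘(ℝ, E) p}
    (hη : S.η p T = 0) (hT : S.g.inner p T T = 1) :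
    riemann S.g p T (S.φ p T) T = -c • S.φ p T := by
  have hp := mem_extChartAt_source (I := 𝓘(ℝ, E)) p
  have hy := mem_extChartAt_target (I := 𝓘(ℝ, E)) p
  have hc : ∀ X, S.ηInChart p (extChartAt 𝓘(ℝ, E) p p) X = 0 →
      metricInChart S.g p (extChartAt 𝓘(ℝ, E) p p) X X = 1 →
      metricInChart S.g p (extChartAt 𝓘(ℝ, E) p p)
        (curvature (metricInChart S.g p) (extChartAt 𝓘(ℝ, E) p p) X
          (S.φInChart p (extChartAt 𝓘(ℝ, E) p p) X)
          (S.φInChart p (extChartAt 𝓘(ℝ, E) p p) X)) X = c := by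
    intro X h1 h2
    rw [← toChart_ofChart hp X, S.ηInChart_apply hp] at h1
    rw [← toChart_ofChart hp X, metricInChart_apply S.g hp] at h2
    have h := hS.phi_sectional p (ofChart p p X) h1 h2
    rw [riemann, ← metricInChart_apply S.g hp, toChart_ofChart hp, ← S.φInChart_apply hp,
      toChart_ofChart hp] at h
    exact h
  have h := (hS.sasakian.isSasakianOn p).curvature_phi_self hy hc
    (T := toChart p p T) (by rw [S.ηInChart_apply hp, hη]) (by rw [metricInChart_apply S.g hp, hT])
  rw [riemann, ← S.φInChart_apply hp, h, S.φInChart_apply hp, map_smul, ofChart_toChart hp]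

end Pointwise

/-! ### Covariant differentiation along a curve. -/

section AlongCurve

variable {E : Type*} [NormedAddCommGroup E] [NormedSpace ℝ E]
  {M : Type*} [TopologicalSpace M] [ChartedSpace E M] [IsManifold 𝓘(ℝ, E) ∞ M]

/-- The vector field `V` along `γ` is differentiable at `t`. -/
def DifferentiableAlong (γ : ℝ → M) (V : ∀ t, TangentSpace 𝓘(ℝ, E) (γ t)) (t : ℝ) : Prop :=
  DifferentiableAt ℝ (fun s => toChart (γ t) (γ s) (V s)) t

variable {γ : ℝ → M} {V W : ∀ t, TangentSpace 𝓘(ℝ, E) (γ t)} {t : ℝ}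

omit [IsManifold 𝓘(ℝ, E) ∞ M] in
lemma eventually_mem_source (hγ : ContinuousAt γ t) :
    ∀ᶠ s in 𝓝 t, γ s ∈ (extChartAt 𝓘(ℝ, E) (γ t)).source :=
  hγ (extChartAt_source_mem_nhds (I := 𝓘(ℝ, E)) (γ t))

lemma hasDerivAt_extChartAt (hγ : MDifferentiableAt 𝓘(ℝ, ℝ) 𝓘(ℝ, E) γ t) :
    HasDerivAt (fun s => extChartAt 𝓘(ℝ, E) (γ t) (γ s))
      (toChart (γ t) (γ t) (velocity γ t)) t := by
  have hp := mem_chart_source E (γ t)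
  have h1 := (mdifferentiableAt_extChartAt (I := 𝓘(ℝ, E)) hp).hasMFDerivAt
  have h2 : HasFDerivAt (fun s => extChartAt 𝓘(ℝ, E) (γ t) (γ s))
      (ContinuousLinearMap.comp (show E →L[ℝ] E from
        mfderiv 𝓘(ℝ, E) 𝓘(ℝ, E) (extChartAt 𝓘(ℝ, E) (γ t)) (γ t))
        (show ℝ →L[ℝ] E from mfderiv 𝓘(ℝ, ℝ) 𝓘(ℝ, E) γ t)) t :=
    (h1.comp t hγ.hasMFDerivAt).hasFDerivAt
  have h3 := h2.hasDerivAt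
  rw [toChart, TangentBundle.continuousLinearMapAt_trivializationAt hp]
  exact h3

lemma differentiableAlong_of_contMDiffOn {J : Set ℝ} (hJ : IsOpen J) (ht : t ∈ J)
    (hV : ContMDiffOn 𝓘(ℝ, ℝ) (𝓘(ℝ, E).prod 𝓘(ℝ, E)) ∞
      (fun t => (⟨γ t, V t⟩ : TangentBundle 𝓘(ℝ, E) M)) J)
    (hγ : ContinuousAt γ t) : DifferentiableAlong γ V t := by
  have h := hV.contMDiffAt (hJ.mem_nhds ht)
  rw [contMDiffAt_totalSpace] at h
  have h2 := (contMDiffAt_iff_contDiffAt.1 h.2).differentiableAt (by simp)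
  refine h2.congr_of_eventuallyEq ?_
  filter_upwards [eventually_mem_source (E := E) hγ] with s hs using toChart_apply hs _

lemma DifferentiableAlong.congr (hV : DifferentiableAlong γ V t) (h : ∀ᶠ s in 𝓝 t, W s = V s) :
    DifferentiableAlong γ W t :=
  DifferentiableAt.congr_of_eventuallyEq hV (h.mono fun s hs => by simp only [hs])

lemma DifferentiableAlong.add (hV : DifferentiableAlong γ V t) (hW : DifferentiableAlong γ W t) :
    DifferentiableAlong γ (fun s => V s + W s) t := by
  have h := DifferentiableAt.fun_add hV hW
  simpa only [DifferentiableAlong, map_add] using h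

lemma DifferentiableAlong.smul {f : ℝ → ℝ} (hf : DifferentiableAt ℝ f t)
    (hV : DifferentiableAlong γ V t) : DifferentiableAlong γ (fun s => f s • V s) t := by
  have h := DifferentiableAt.fun_smul hf hV
  simpa only [DifferentiableAlong, map_smul] using h

lemma covDeriv_congr (g : Metric E M) (h : ∀ᶠ s in 𝓝 t, V s = W s) :
    covDeriv g γ V t = covDeriv g γ W t := by
  have h1 : (fun s => toChart (γ t) (γ s) (V s)) =ᶠ[𝓝 t] fun s => toChart (γ t) (γ s) (W s) :=
    h.mono fun s hs => by simp only [hs]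
  rw [covDeriv, covDeriv, h1.deriv_eq, h.self_of_nhds]

lemma covDeriv_add (g : Metric E M) (hV : DifferentiableAlong γ V t)
    (hW : DifferentiableAlong γ W t) :
    covDeriv g γ (fun s => V s + W s) t = covDeriv g γ V t + covDeriv g γ W t := by
  have h := deriv_fun_add hV hW
  simp only [covDeriv, map_add, ← christoffelCLM_apply]
  rw [h]
  simp only [map_add]
  abel

lemma covDeriv_smul (g : Metric E M) {f : ℝ → ℝ} (hf : DifferentiableAt ℝ f t)
    (hV : DifferentiableAlong γ V t) :
    covDeriv g γ (fun s => f s • V s) t = deriv f t • V t + f t • covDeriv g γ V t := by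
  have h := deriv_fun_smul hf hV
  simp only [covDeriv, map_smul, ← christoffelCLM_apply]
  rw [h]
  simp only [map_add, map_smul, ofChart_toChart (mem_extChartAt_source (I := 𝓘(ℝ, E)) (γ t))]
  module

namespace AlmostContactMetric.IsSasakian

variable [FiniteDimensional ℝ E] {S : AlmostContactMetric E M} (hS : S.IsSasakian)
  (hγ : MDifferentiableAt 𝓘(ℝ, ℝ) 𝓘(ℝ, E) γ t)
include hS hγ

lemma covDeriv_ξ :
    covDeriv S.g γ (fun s => S.ξ (γ s)) t = -S.φ (γ t) (velocity γ t) := by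
  have hp := mem_extChartAt_source (I := 𝓘(ℝ, E)) (γ t)
  have hy := mem_extChartAt_target (I := 𝓘(ℝ, E)) (γ t)
  have hL := hS.isSasakianOn (γ t)
  have h1 : (fun s => toChart (γ t) (γ s) (S.ξ (γ s)))
      =ᶠ[𝓝 t] fun s => S.ξInChart (γ t) (extChartAt 𝓘(ℝ, E) (γ t) (γ s)) := by
    filter_upwards [eventually_mem_source (E := E) hγ.continuousAt] with s hs
      using (S.ξInChart_apply hs).symm
  have h2 := ((hL.differentiableAt_ξ hy).hasFDerivAt.comp_hasDerivAt t
    (hasDerivAt_extChartAt hγ)).deriv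
  have h3 := hL.covDeriv_ξ hy (toChart (γ t) (γ t) (velocity γ t))
  rw [covDeriv, h1.deriv_eq, ← S.ξInChart_apply hp, ← christoffelCLM_apply]
  erw [h2]
  rw [h3, S.φInChart_apply hp, map_neg, ofChart_toChart hp]

/-- The chain and product rules along `γ`, combined with the local formula for `∇φ`. -/
lemma covDeriv_φ (hV : DifferentiableAlong γ V t) :
    covDeriv S.g γ (fun s => S.φ (γ s) (V s)) t = S.φ (γ t) (covDeriv S.g γ V t)
      + S.g.inner (γ t) (velocity γ t) (V t) • S.ξ (γ t)
      - S.η (γ t) (V t) • velocity γ t := by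
  have hp := mem_extChartAt_source (I := 𝓘(ℝ, E)) (γ t)
  have hy := mem_extChartAt_target (I := 𝓘(ℝ, E)) (γ t)
  have hL := hS.isSasakianOn (γ t)
  have h1 : (fun s => toChart (γ t) (γ s) (S.φ (γ s) (V s)))
      =ᶠ[𝓝 t] fun s => S.φInChart (γ t) (extChartAt 𝓘(ℝ, E) (γ t) (γ s))
        (toChart (γ t) (γ s) (V s)) := by
    filter_upwards [eventually_mem_source (E := E) hγ.continuousAt] with s hs
      using (S.φInChart_apply hs _).symm
  have h2 := ((hL.differentiableAt_φ hy).hasFDerivAt.comp_hasDerivAt t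
    (hasDerivAt_extChartAt hγ)).clm_apply hV.hasDerivAt
  have h3 := hL.fderiv_φ hy (toChart (γ t) (γ t) (velocity γ t)) (toChart (γ t) (γ t) (V t))
  apply_fun toChart (γ t) (γ t) using
    Function.LeftInverse.injective (g := ofChart (γ t) (γ t)) (ofChart_toChart hp)
  rw [map_sub, map_add, map_smul, map_smul, ← S.φInChart_apply hp, ← S.ξInChart_apply hp,
    ← metricInChart_apply S.g hp, ← S.ηInChart_apply hp, covDeriv, covDeriv, h1.deriv_eq,
    toChart_ofChart hp, toChart_ofChart hp, ← christoffelCLM_apply, ← christoffelCLM_apply,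
    ← S.φInChart_apply hp]
  erw [h2.deriv, h3]
  rw [map_add]
  simp only [Function.comp_apply]
  abel

end AlmostContactMetric.IsSasakian

end AlongCurve

/-! ### Frenet curves and the frame `T, φT, ξ`. -/

section FrenetCurves

variable {E : Type*} [NormedAddCommGroup E] [NormedSpace ℝ E]
  {M : Type*} [TopologicalSpace M] [ChartedSpace E M] [IsManifold 𝓘(ℝ, E) ∞ M]
  {γ : ℝ → M} {J : Set ℝ} {r : ℕ} {F : ℕ → ∀ t, TangentSpace 𝓘(ℝ, E) (γ t)} {k : ℕ → ℝ → ℝ}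

namespace IsFrenetCurve

variable {g : Metric E M} (hF : IsFrenetCurve g J γ r F k)

include hF in
-- Lets a curvature that is constant on `J` be replaced by that constant, as `IsHelix` requires.
lemma congr_curvature {k' : ℕ → ℝ → ℝ} (hk : ∀ i ∈ Finset.Ico 1 r, ∀ t ∈ J, k' i t = k i t) :
    IsFrenetCurve g J γ r F k' where
  one_le := hF.one_le
  smooth_curve := hF.smooth_curve
  smooth_frame := hF.smooth_frame
  smooth_curvature i hi := (hF.smooth_curvature i hi).congr (hk i hi)
  curvature_nonneg i hi t ht := by rw [hk i hi t ht]; exact hF.curvature_nonneg i hi t ht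
  orthonormal := hF.orthonormal
  frame_one := hF.frame_one
  frenet t ht i hi := by
    rw [hF.frenet t ht i hi]
    have hi' := Finset.mem_Icc.1 hi
    congr 1
    · split_ifs with h
      · rw [hk (i - 1) (Finset.mem_Ico.2 (by omega)) t ht]
      · rfl
    · split_ifs with h
      · rw [hk i (Finset.mem_Ico.2 (by omega)) t ht]
      · rfl

variable (hJ : IsOpen J)
include hF hJ

lemma mdifferentiableAt {t : ℝ} (ht : t ∈ J) : MDifferentiableAt 𝓘(ℝ, ℝ) 𝓘(ℝ, E) γ t :=
  (hF.smooth_curve.contMDiffAt (hJ.mem_nhds ht)).mdifferentiableAt (by simp)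

lemma differentiableAlong {t : ℝ} (ht : t ∈ J) {i : ℕ} (hi : i ∈ Finset.Icc 1 r) :
    DifferentiableAlong γ (F i) t :=
  differentiableAlong_of_contMDiffOn hJ ht (hF.smooth_frame i hi)
    (hF.mdifferentiableAt hJ ht).continuousAt

lemma covDeriv_velocity (hr : 2 ≤ r) {t : ℝ} (ht : t ∈ J) :
    covDeriv g γ (velocity γ) t = k 1 t • F 2 t := by
  have h : ∀ᶠ s in 𝓝 t, velocity γ s = F 1 s := by
    filter_upwards [hJ.mem_nhds ht] with s hs using (hF.frame_one s hs).symm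
  rw [covDeriv_congr g h, hF.frenet t ht 1 (Finset.mem_Icc.2 ⟨le_rfl, by omega⟩)]
  rw [if_neg (by omega), if_pos (by omega), zero_add]

lemma isGeodesic_iff (hr : 2 ≤ r) : IsGeodesic g J γ ↔ ∀ t ∈ J, k 1 t = 0 := by
  refine forall₂_congr fun t ht => ?_
  rw [hF.covDeriv_velocity hJ hr ht]
  refine ⟨fun h => ?_, fun h => by rw [h, zero_smul]⟩
  have h2 := hF.orthonormal t ht 2 (Finset.mem_Icc.2 ⟨by omega, hr⟩) 2
    (Finset.mem_Icc.2 ⟨by omega, hr⟩)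
  have h3 : g.inner (γ t) (k 1 t • F 2 t) (F 2 t) = 0 := by rw [h, map_zero]; rfl
  rw [map_smul, smul_apply, h2] at h3
  simpa using h3

lemma differentiableAt_curvature {t : ℝ} (ht : t ∈ J) {i : ℕ} (hi : i ∈ Finset.Ico 1 r) :
    DifferentiableAt ℝ (k i) t :=
  differentiableAt_of_contDiffOn hJ (hF.smooth_curvature i hi) ht

lemma differentiableAt_deriv_curvature {t : ℝ} (ht : t ∈ J) {i : ℕ} (hi : i ∈ Finset.Ico 1 r) :
    DifferentiableAt ℝ (deriv (k i)) t :=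
  differentiableAt_of_contDiffOn hJ
    ((hF.smooth_curvature i hi).deriv_of_isOpen hJ (m := ∞) (by simp)) ht

end IsFrenetCurve

lemma riemann_smul_snd [FiniteDimensional ℝ E] (g : Metric E M) {p : M} (a : ℝ)
    (X Y Z : TangentSpace 𝓘(ℝ, E) p) : riemann g p X (a • Y) Z = a • riemann g p X Y Z := by
  rw [riemann, riemann, map_smul, (isMetricOn_metricInChart g p).curvature_smul_snd
    (mem_extChartAt_target (I := 𝓘(ℝ, E)) p), map_smul]

/-- The curve has a Frenet frame starting with `T, ε φT, ε ξ` and `k 2 = 1`, `k 3 = 0`. -/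
structure HasSasakianFrame (S : AlmostContactMetric E M) (J : Set ℝ) (γ : ℝ → M) (r : ℕ)
    (F : ℕ → ∀ t, TangentSpace 𝓘(ℝ, E) (γ t)) (k : ℕ → ℝ → ℝ) (ε : ℝ) : Prop where
  sign : ε = 1 ∨ ε = -1
  three_le : 3 ≤ r
  frame_two : ∀ t ∈ J, F 2 t = ε • S.φ (γ t) (velocity γ t)
  frame_three : ∀ t ∈ J, F 3 t = ε • S.ξ (γ t)
  curvature_two : ∀ t ∈ J, k 2 t = 1
  curvature_three : 3 < r → ∀ t ∈ J, k 3 t = 0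

namespace AlmostContactMetric

variable (S : AlmostContactMetric E M)

lemma g_ξ (p : M) (X : TangentSpace 𝓘(ℝ, E) p) : S.g.inner p X (S.ξ p) = S.η p X :=
  inner_xi (S.φ_sq p) (S.η_ξ p) (S.compatible p) X

variable {S}

/-- `g(φT, E₂)` is continuous with values in `{1, -1}`, because `φT` is a unit multiple of `E₂`; on
an interval it is constant. -/
lemma exists_sign (hJ_conn : J.OrdConnected)
    (hJ_ne : J.Nonempty) (hr : 2 ≤ r) (hF : IsFrenetCurve S.g J γ r F k)
    (hLegendre : S.IsLegendre J γ)
    (hparallel : ∀ t ∈ J, ∃ a : ℝ, S.φ (γ t) (velocity γ t) = a • F 2 t) :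
    ∃ ε : ℝ, (ε = 1 ∨ ε = -1) ∧ ∀ t ∈ J, F 2 t = ε • S.φ (γ t) (velocity γ t) := by
  have h1 : 1 ∈ Finset.Icc 1 r := Finset.mem_Icc.2 ⟨le_rfl, by omega⟩
  have h2 : 2 ∈ Finset.Icc 1 r := Finset.mem_Icc.2 ⟨by omega, hr⟩
  set a : ℝ → ℝ := fun t => S.g.inner (γ t) (S.φ (γ t) (F 1 t)) (F 2 t) with ha
  have hφ : ∀ t ∈ J, S.φ (γ t) (velocity γ t) = a t • F 2 t := by
    intro t ht
    obtain ⟨b, hb⟩ := hparallel t ht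
    have : a t = b := by
      simp only [ha]
      rw [hF.frame_one t ht, hb, map_smul, smul_apply, hF.orthonormal t ht 2 h2 2 h2]
      simp
    rw [this, hb]
  have hsq : ∀ t ∈ J, a t * a t = 1 := by
    intro t ht
    have h := S.compatible (γ t) (velocity γ t) (velocity γ t)
    rw [hLegendre t ht, ← hF.frame_one t ht, hF.orthonormal t ht 1 h1 1 h1, hF.frame_one t ht,
      hφ t ht, map_smul, map_smul, smul_apply, hF.orthonormal t ht 2 h2 2 h2] at h
    simpa using h
  have hcont : ContinuousOn a J := by
    have hφγ := S.smooth_φ.comp_contMDiffOn hF.smooth_curve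
    have hgγ := S.g.contMDiff.comp_contMDiffOn hF.smooth_curve
    have hv := ContMDiffOn.clm_bundle_apply (F₁ := E) (F₂ := E) hφγ (hF.smooth_frame 1 h1)
    have h : ContMDiffOn 𝓘(ℝ, ℝ) (𝓘(ℝ, E).prod 𝓘(ℝ, ℝ)) ∞
        (fun t => TotalSpace.mk' ℝ (E := Bundle.Trivial M ℝ) (γ t) (a t)) J :=
      ContMDiffOn.clm_bundle_apply₂ (F₁ := E) (F₂ := E) hgγ hv (hF.smooth_frame 2 h2)
    intro t ht
    have h' := h t ht
    simp only [contMDiffWithinAt_totalSpace] at h'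
    exact h'.2.continuousWithinAt
  have hmaps : MapsTo a J ({1, -1} : Set ℝ) := fun t ht => by
    have := mul_self_eq_one_iff.1 (hsq t ht)
    simpa using this
  obtain ⟨t₀, ht₀⟩ := hJ_ne
  have hfin : ({1, -1} : Set ℝ).Finite := by simp
  have : DiscreteTopology ({1, -1} : Set ℝ) := hfin.instDiscreteTopology
  refine ⟨a t₀, by simpa using hmaps ht₀, fun t ht => ?_⟩
  rw [hJ_conn.isPreconnected.constant_of_mapsTo ⟨this⟩ hcont hmaps ht₀ ht, hφ t ht, smul_smul, hsq t ht,
    one_smul]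

variable [FiniteDimensional ℝ E]

lemma IsSasakian.exists_hasSasakianFrame (hS : S.IsSasakian) (hJ : IsOpen J)
    (hJ_conn : J.OrdConnected) (hJ_ne : J.Nonempty) (hr : 2 ≤ r)
    (hF : IsFrenetCurve S.g J γ r F k) (hLegendre : S.IsLegendre J γ)
    (hparallel : ∀ t ∈ J, ∃ a : ℝ, S.φ (γ t) (velocity γ t) = a • F 2 t) :
    ∃ ε, HasSasakianFrame S J γ r F k ε := by
  obtain ⟨ε, hε, hF2⟩ := exists_sign hJ_conn hJ_ne hr hF hLegendre hparallel
  have hεε : ε * ε = 1 := by rcases hε with rfl | rfl <;> norm_num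
  have h1 : 1 ∈ Finset.Icc 1 r := Finset.mem_Icc.2 ⟨le_rfl, by omega⟩
  have h2 : 2 ∈ Finset.Icc 1 r := Finset.mem_Icc.2 ⟨by omega, hr⟩
  have hφT : ∀ t ∈ J, S.φ (γ t) (velocity γ t) = ε • F 2 t := fun t ht => by
    rw [hF2 t ht, smul_smul, hεε, one_smul]
  have hφφ : ∀ t ∈ J, S.φ (γ t) (F 2 t) = -ε • velocity γ t := fun t ht => by
    rw [hF2 t ht, map_smul, S.φ_sq, hLegendre t ht]; simp
  have hTT : ∀ t ∈ J, S.g.inner (γ t) (velocity γ t) (velocity γ t) = 1 := fun t ht => by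
    rw [← hF.frame_one t ht, hF.orthonormal t ht 1 h1 1 h1, if_pos rfl]
  -- Two expressions for `∇_T E₂` share the term `-k₁ T`, and the rest is compared. Keeping the
  -- conditional covers `r = 2`, which is then excluded because `ξ ≠ 0`.
  have hcF2 : ∀ t ∈ J, (if 2 < r then k 2 t • F 3 t else 0) = ε • S.ξ (γ t) := by
    intro t ht
    have hγ := hF.mdifferentiableAt hJ ht
    have hdT : DifferentiableAlong (E := E) γ (velocity γ) t := by
      refine (hF.differentiableAlong hJ ht h1).congr ?_
      filter_upwards [hJ.mem_nhds ht] with s hs using (hF.frame_one s hs).symm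
    have hdφ : DifferentiableAlong γ (fun s => S.φ (γ s) (velocity γ s)) t := by
      refine ((hF.differentiableAlong hJ ht h2).smul (differentiableAt_const ε)).congr ?_
      filter_upwards [hJ.mem_nhds ht] with s hs using hφT s hs
    have e1 : covDeriv S.g γ (F 2) t
        = covDeriv S.g γ (fun s => ε • S.φ (γ s) (velocity γ s)) t := by
      refine covDeriv_congr _ ?_
      filter_upwards [hJ.mem_nhds ht] with s hs using hF2 s hs
    rw [covDeriv_smul _ (differentiableAt_const ε) hdφ, hS.covDeriv_φ hγ hdT, hTT t ht,
      hLegendre t ht, hF.covDeriv_velocity hJ hr ht, map_smul, hφφ t ht,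
      hF.frenet t ht 2 h2, if_pos (by omega), hF.frame_one t ht, deriv_const] at e1
    rw [eq_sub_of_add_eq' e1]
    have e2 : ε • k 1 t • -ε • velocity (E := E) γ t = -k 1 t • velocity (E := E) γ t := by
      rw [smul_smul, smul_smul]; congr 1; linear_combination (-k 1 t) * hεε
    simp only [smul_sub, smul_add, e2]
    simp
  have hξξ : ∀ p, S.g.inner p (S.ξ p) (S.ξ p) = 1 := fun p => by rw [S.g_ξ, S.η_ξ]
  have hr3 : 2 < r := by
    by_contra hr3
    obtain ⟨t, ht⟩ := hJ_ne
    have h := congrArg (S.η (γ t)) (hcF2 t ht)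
    rw [if_neg hr3, map_smul, S.η_ξ, map_zero, smul_eq_mul, mul_one] at h
    rw [← h] at hεε
    norm_num at hεε
  simp only [if_pos hr3] at hcF2
  have h3 : 3 ∈ Finset.Icc 1 r := Finset.mem_Icc.2 ⟨by omega, hr3⟩
  -- Taking norms gives `k₂² = 1`, and nonnegativity selects the sign; so `E₃` carries the same `ε`
  -- as `E₂`.
  have hk2 : ∀ t ∈ J, k 2 t = 1 := by
    intro t ht
    have h0 := hF.curvature_nonneg 2 (Finset.mem_Ico.2 ⟨by omega, hr3⟩) t ht
    have h : S.g.inner (γ t) (k 2 t • F 3 t) (k 2 t • F 3 t) = 1 := by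
      rw [hcF2 t ht, map_smul, map_smul, smul_apply, hξξ]; simpa using hεε
    rw [map_smul, map_smul, smul_apply, hF.orthonormal t ht 3 h3 3 h3] at h
    simp only [if_true, smul_eq_mul, mul_one] at h
    nlinarith
  have hF3 : ∀ t ∈ J, F 3 t = ε • S.ξ (γ t) := fun t ht => by
    rw [← hcF2 t ht, hk2 t ht, one_smul]
  refine ⟨ε, hε, hr3, hF2, hF3, hk2, fun hr4 t ht => ?_⟩
  have hγ := hF.mdifferentiableAt hJ ht
  have hdξ : DifferentiableAlong γ (fun s => S.ξ (γ s)) t := by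
    refine ((hF.differentiableAlong hJ ht h3).smul (differentiableAt_const ε)).congr ?_
    filter_upwards [hJ.mem_nhds ht] with s hs
    rw [hF3 s hs, smul_smul, hεε, one_smul]
  have e1 : covDeriv S.g γ (F 3) t = covDeriv S.g γ (fun s => ε • S.ξ (γ s)) t := by
    refine covDeriv_congr _ ?_
    filter_upwards [hJ.mem_nhds ht] with s hs using hF3 s hs
  rw [covDeriv_smul _ (differentiableAt_const ε) hdξ, hS.covDeriv_ξ hγ, hF.frenet t ht 3 h3,
    if_pos (by omega), if_pos hr4, deriv_const, zero_smul, zero_add, smul_neg, ← hF2 t ht,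
    show 3 - 1 = 2 from rfl, hk2 t ht, neg_smul, one_smul] at e1
  have e2 := congrArg (fun x => S.g.inner (γ t) x (F 4 t)) (left_eq_add.1 e1.symm)
  have h4 : 4 ∈ Finset.Icc 1 r := Finset.mem_Icc.2 ⟨by omega, hr4⟩
  simp only [map_smul, smul_apply] at e2
  rw [hF.orthonormal t ht 4 h4 4 h4, map_zero] at e2
  simpa using e2

end AlmostContactMetric

end FrenetCurves

/-! ### The bitension field and the reduced equation for `k₁`. -/

section SesquiHarmonicCurves

variable {E : Type*} [NormedAddCommGroup E] [NormedSpace ℝ E]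
  {M : Type*} [TopologicalSpace M] [ChartedSpace E M] [IsManifold 𝓘(ℝ, E) ∞ M]
  {γ : ℝ → M} {J : Set ℝ} {r : ℕ} {F : ℕ → ∀ t, TangentSpace 𝓘(ℝ, E) (γ t)} {k : ℕ → ℝ → ℝ}
  {S : AlmostContactMetric E M} {ε : ℝ}

namespace HasSasakianFrame

variable (hH : HasSasakianFrame S J γ r F k ε)
include hH

/-- `T, ε φT, ε ξ` is a Frenet frame of osculating order three. -/
lemma isFrenetCurve (hJ : IsOpen J) (hF : IsFrenetCurve S.g J γ r F k) :
    IsFrenetCurve S.g J γ 3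
      (fun i t => if i = 1 then velocity γ t
        else if i = 2 then ε • S.φ (γ t) (velocity γ t) else ε • S.ξ (γ t))
      (fun i t => if i = 1 then k 1 t else 1) := by
  have h3 := hH.three_le
  set F' : ℕ → ∀ t, TangentSpace 𝓘(ℝ, E) (γ t) := fun i t => if i = 1 then velocity γ t
    else if i = 2 then ε • S.φ (γ t) (velocity γ t) else ε • S.ξ (γ t) with hF'
  have hmem : ∀ i ∈ Finset.Icc 1 3, i ∈ Finset.Icc 1 r := fun i hi =>
    Finset.Icc_subset_Icc_right h3 hi
  have hmem' : ∀ i ∈ Finset.Ico 1 3, i ∈ Finset.Ico 1 r := fun i hi =>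
    Finset.Ico_subset_Ico_right h3 hi
  have heq : ∀ t ∈ J, ∀ i ∈ Finset.Icc 1 3, F' i t = F i t := by
    intro t ht i hi
    have hi' := Finset.mem_Icc.1 hi
    obtain rfl | rfl | rfl : i = 1 ∨ i = 2 ∨ i = 3 := by omega
    · simpa [hF'] using (hF.frame_one t ht).symm
    · simpa [hF'] using (hH.frame_two t ht).symm
    · simpa [hF'] using (hH.frame_three t ht).symm
  have hk : ∀ t ∈ J, ∀ i ∈ Finset.Ico 1 3, (if i = 1 then k 1 t else 1) = k i t := by
    intro t ht i hi
    have hi' := Finset.mem_Ico.1 hi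
    obtain rfl | rfl : i = 1 ∨ i = 2 := by omega
    · rfl
    · exact (hH.curvature_two t ht).symm
  refine ⟨by norm_num, hF.smooth_curve, fun i hi => ?_, fun i hi => ?_, fun i hi t ht => ?_,
    fun t ht i hi j hj => ?_, fun t ht => rfl, fun t ht i hi => ?_⟩
  · exact (hF.smooth_frame i (hmem i hi)).congr fun t ht => by rw [heq t ht i hi]
  · exact (hF.smooth_curvature i (hmem' i hi)).congr fun t ht => hk t ht i hi
  · rw [hk t ht i hi]; exact hF.curvature_nonneg i (hmem' i hi) t ht
  · rw [heq t ht i hi, heq t ht j hj]; exact hF.orthonormal t ht i (hmem i hi) j (hmem j hj)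
  · have hc : covDeriv S.g γ (F' i) t = covDeriv S.g γ (F i) t := by
      refine covDeriv_congr _ ?_
      filter_upwards [hJ.mem_nhds ht] with s hs using heq s hs i hi
    rw [hc, hF.frenet t ht i (hmem i hi)]
    have hi' := Finset.mem_Icc.1 hi
    obtain rfl | rfl | rfl : i = 1 ∨ i = 2 ∨ i = 3 := by omega
    · rw [if_neg (by norm_num), if_pos (by omega), if_neg (by norm_num), if_pos (by norm_num),
        heq t ht 2 (by simp)]
      rfl
    · rw [if_pos (by norm_num), if_pos (by omega), if_pos (by norm_num), if_pos (by norm_num),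
        heq t ht 3 (by simp), heq t ht 1 (by simp), hH.curvature_two t ht]
      rfl
    -- Truncating the frame after three fields is legitimate because `k₃ = 0`.
    · have h0 : (if 3 < r then k 3 t • F (3 + 1) t else 0) = 0 := by
        split_ifs with h
        · rw [hH.curvature_three h t ht, zero_smul]
        · rfl
      rw [h0, if_pos (by norm_num), if_pos (by norm_num), if_neg (lt_irrefl 3),
        heq t ht 2 (by simp), hH.curvature_two t ht]
      rfl

variable [FiniteDimensional ℝ E]

/-- Differentiate `τ = k₁ E₂` twice by the Frenet equations with `k₂ = 1`, `k₃ = 0`; the curvature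
contributes only `c k₁ E₂`, as `E₂ = ε φT`. -/
lemma bitension_eq {c : ℝ} (hS : S.IsSasakianSpaceForm c) (hJ : IsOpen J)
    (hF : IsFrenetCurve S.g J γ r F k) (hLegendre : S.IsLegendre J γ) {t : ℝ} (ht : t ∈ J) :
    bitension S.g γ t = (-3 * (k 1 t * deriv (k 1) t)) • F 1 t
      + (deriv (deriv (k 1)) t - k 1 t - k 1 t ^ 3 + c * k 1 t) • F 2 t
      + (2 * deriv (k 1) t) • F 3 t := by
  have h3r := hH.three_le
  have h2r : 2 ≤ r := by omega
  have h1 : 1 ∈ Finset.Icc 1 r := Finset.mem_Icc.2 ⟨le_rfl, by omega⟩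
  have h2 : 2 ∈ Finset.Icc 1 r := Finset.mem_Icc.2 ⟨by omega, h2r⟩
  have h3 : 3 ∈ Finset.Icc 1 r := Finset.mem_Icc.2 ⟨by omega, h3r⟩
  have hk1 : 1 ∈ Finset.Ico 1 r := Finset.mem_Ico.2 ⟨le_rfl, by omega⟩
  have hεε : ε * ε = 1 := by rcases hH.sign with h | h <;> rw [h] <;> norm_num
  have c1 : ∀ s ∈ J, covDeriv S.g γ (F 1) s = k 1 s • F 2 s := fun s hs => by
    rw [hF.frenet s hs 1 h1, if_neg (by norm_num), if_pos (by omega), zero_add]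
  have c2 : ∀ s ∈ J, covDeriv S.g γ (F 2) s = -k 1 s • F 1 s + F 3 s := fun s hs => by
    rw [hF.frenet s hs 2 h2, if_pos (by norm_num), if_pos (by omega), hH.curvature_two s hs,
      one_smul]
  have c3 : ∀ s ∈ J, covDeriv S.g γ (F 3) s = -F 2 s := fun s hs => by
    rw [hF.frenet s hs 3 h3, if_pos (by norm_num), show 3 - 1 = 2 from rfl,
      hH.curvature_two s hs, neg_smul, one_smul]
    split_ifs with h
    · rw [hH.curvature_three h s hs, zero_smul, add_zero]
    · rw [add_zero]
  have hτ : ∀ s ∈ J, tension S.g γ s = k 1 s • F 2 s := fun s hs =>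
    hF.covDeriv_velocity hJ h2r hs
  have d : ∀ s ∈ J, DifferentiableAt ℝ (k 1) s := fun s hs =>
    hF.differentiableAt_curvature hJ hs hk1
  have hdτ : ∀ s ∈ J, covDeriv S.g γ (tension S.g γ) s
      = deriv (k 1) s • F 2 s + (k 1 s • F 3 s + (-(k 1 s) ^ 2) • F 1 s) := by
    intro s hs
    have e : ∀ᶠ x in 𝓝 s, tension S.g γ x = k 1 x • F 2 x := by
      filter_upwards [hJ.mem_nhds hs] with x hx using hτ x hx
    rw [covDeriv_congr S.g e, covDeriv_smul S.g (d s hs) (hF.differentiableAlong hJ hs h2),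
      c2 s hs]
    module
  have e : ∀ᶠ x in 𝓝 t, covDeriv S.g γ (tension S.g γ) x
      = deriv (k 1) x • F 2 x + (k 1 x • F 3 x + (-(k 1 x) ^ 2) • F 1 x) := by
    filter_upwards [hJ.mem_nhds ht] with x hx using hdτ x hx
  have dd := hF.differentiableAt_deriv_curvature hJ ht hk1
  have dq : HasDerivAt (fun x => -(k 1 x) ^ 2) (-(2 * k 1 t * deriv (k 1) t)) t := by
    simpa using ((d t ht).hasDerivAt.fun_pow 2).fun_neg
  have a1 := hF.differentiableAlong hJ ht h1
  have a2 := hF.differentiableAlong hJ ht h2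
  have a3 := hF.differentiableAlong hJ ht h3
  have hR : riemann S.g (γ t) (velocity γ t) (k 1 t • F 2 t) (velocity γ t)
      = (-c * k 1 t) • F 2 t := by
    rw [hH.frame_two t ht, riemann_smul_snd, riemann_smul_snd,
      hS.riemann_phi_self (hLegendre t ht) (by
        rw [← hF.frame_one t ht, hF.orthonormal t ht 1 h1 1 h1, if_pos rfl])]
    module
  rw [bitension, covDeriv_congr S.g e, hτ t ht, hR,
    covDeriv_add S.g (a2.smul dd) ((a3.smul (d t ht)).add (a1.smul dq.differentiableAt)),
    covDeriv_add S.g (a3.smul (d t ht)) (a1.smul dq.differentiableAt),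
    covDeriv_smul S.g dd a2, covDeriv_smul S.g (d t ht) a3,
    covDeriv_smul S.g dq.differentiableAt a1, c1 t ht, c2 t ht, c3 t ht, dq.deriv]
  module

/-- The interpolating sesqui-harmonic map equation in terms of the first curvature. -/
lemma isInterpolatingSesquiHarmonic_iff {c δ₁ δ₂ : ℝ} (hS : S.IsSasakianSpaceForm c)
    (hJ : IsOpen J) (hF : IsFrenetCurve S.g J γ r F k) (hLegendre : S.IsLegendre J γ)
    (hδ₂ : δ₂ ≠ 0) :
    IsInterpolatingSesquiHarmonic S.g δ₁ δ₂ J γ ↔ ∀ t ∈ J, deriv (k 1) t = 0 ∧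
      k 1 t * (k 1 t ^ 2 - (c - 1 - δ₁ / δ₂)) = 0 := by
  have h3r := hH.three_le
  have h1 : 1 ∈ Finset.Icc 1 r := Finset.mem_Icc.2 ⟨le_rfl, by omega⟩
  have h2 : 2 ∈ Finset.Icc 1 r := Finset.mem_Icc.2 ⟨by omega, by omega⟩
  have h3 : 3 ∈ Finset.Icc 1 r := Finset.mem_Icc.2 ⟨by omega, h3r⟩
  have key : ∀ t ∈ J, δ₂ • bitension S.g γ t - δ₁ • tension S.g γ t
      = (δ₂ * (-3 * (k 1 t * deriv (k 1) t))) • F 1 t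
      + (δ₂ * (deriv (deriv (k 1)) t - k 1 t - k 1 t ^ 3 + c * k 1 t) - δ₁ * k 1 t) • F 2 t
      + (δ₂ * (2 * deriv (k 1) t)) • F 3 t := fun t ht => by
    rw [hH.bitension_eq hS hJ hF hLegendre ht, tension,
      hF.covDeriv_velocity hJ (by omega) ht]
    module
  have hdd : (∀ t ∈ J, deriv (k 1) t = 0) → ∀ t ∈ J, deriv (deriv (k 1)) t = 0 := by
    intro h t ht
    have : deriv (k 1) =ᶠ[𝓝 t] fun _ => (0 : ℝ) := by
      filter_upwards [hJ.mem_nhds ht] with s hs using h s hs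
    rw [this.deriv_eq, deriv_const]
  constructor
  · intro h
    -- The `E₂` and `E₃` components suffice: once `k₁' = 0`, the `E₁` component vanishes by itself.
    have hcomp : ∀ t ∈ J, δ₂ * (2 * deriv (k 1) t) = 0 ∧
        δ₂ * (deriv (deriv (k 1)) t - k 1 t - k 1 t ^ 3 + c * k 1 t) - δ₁ * k 1 t = 0 := by
      intro t ht
      have h0 := h t ht
      rw [key t ht] at h0
      have p2 := congrArg (fun x => S.g.inner (γ t) x (F 2 t)) h0
      have p3 := congrArg (fun x => S.g.inner (γ t) x (F 3 t)) h0
      simp only [map_add, map_smul, add_apply, smul_apply] at p2 p3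
      rw [hF.orthonormal t ht 1 h1 2 h2, hF.orthonormal t ht 2 h2 2 h2,
        hF.orthonormal t ht 3 h3 2 h2, map_zero] at p2
      rw [hF.orthonormal t ht 1 h1 3 h3, hF.orthonormal t ht 2 h2 3 h3,
        hF.orthonormal t ht 3 h3 3 h3, map_zero] at p3
      norm_num at p2 p3
      refine ⟨?_, p2⟩
      rcases p3 with p3 | p3
      · exact absurd p3 hδ₂
      · rw [p3]; ring
    have hd : ∀ t ∈ J, deriv (k 1) t = 0 := fun t ht => by
      simpa [hδ₂] using (hcomp t ht).1
    refine fun t ht => ⟨hd t ht, ?_⟩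
    have h2 := (hcomp t ht).2
    rw [hdd hd t ht] at h2
    field_simp
    linarith
  · intro h t ht
    have hd := fun s hs => (h s hs).1
    have h2 := (h t ht).2
    have h4 : δ₂ * (0 - k 1 t - k 1 t ^ 3 + c * k 1 t) - δ₁ * k 1 t = 0 := by
      field_simp at h2
      linarith
    rw [key t ht, hdd hd t ht, hd t ht, h4]
    simp

end HasSasakianFrame

end SesquiHarmonicCurves
end SasakianCurves

end

/-! ### The theorem, from the frame and the reduced equation. -/

open SasakianCurves
theorem mainTheorem7
    {E : Type*} [NormedAddCommGroup E] [NormedSpace ℝ E] [FiniteDimensional ℝ E]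
    {M : Type*} [TopologicalSpace M] [ChartedSpace E M] [IsManifold 𝓘(ℝ, E) ∞ M]
    (n : ℕ) (hdim : Module.finrank ℝ E = 2 * n + 1)
    (S : AlmostContactMetric E M) (c : ℝ) (hS : S.IsSasakianSpaceForm c) (hc : c ≠ 1)
    (J : Set ℝ) (hJ_open : IsOpen J) (hJ_conn : J.OrdConnected) (hJ_ne : J.Nonempty)
    (γ : ℝ → M) (r : ℕ) (hr : 2 ≤ r)
    (F : ℕ → ∀ t, TangentSpace 𝓘(ℝ, E) (γ t)) (k : ℕ → ℝ → ℝ)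
    (hF : IsFrenetCurve S.g J γ r F k) (hLegendre : S.IsLegendre J γ)
    (hparallel : ∀ t ∈ J, ∃ a : ℝ, S.φ (γ t) (velocity γ t) = a • F 2 t)
    (δ₁ δ₂ : ℝ) (hδ₂ : δ₂ ≠ 0) :
    -- `{T, φT, ξ}` is, up to a common sign of the last two fields, the Frenet frame
    (3 ≤ r ∧
      (∃ ε : ℝ, (ε = 1 ∨ ε = -1) ∧
        (∀ t ∈ J, F 1 t = velocity γ t ∧ F 2 t = ε • S.φ (γ t) (velocity γ t) ∧
          F 3 t = ε • S.ξ (γ t)) ∧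
        IsFrenetCurve S.g J γ 3
          (fun i t => if i = 1 then velocity γ t
            else if i = 2 then ε • S.φ (γ t) (velocity γ t) else ε • S.ξ (γ t))
          (fun i t => if i = 1 then k 1 t else 1)) ∧
      (∀ t ∈ J, k 2 t = 1) ∧
      (3 < r → ∀ t ∈ J, k 3 t = 0) ∧
      ((∀ i ∈ Finset.Ico 1 r, ∀ t ∈ J, 0 < k i t) → r = 3)) ∧
    (c < 1 → 0 ≤ δ₁ / δ₂ →
      (IsInterpolatingSesquiHarmonic S.g δ₁ δ₂ J γ ↔ IsGeodesic S.g J γ)) ∧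
    (1 < c → δ₁ / δ₂ < 0 → ¬ IsGeodesic S.g J γ →
      (IsInterpolatingSesquiHarmonic S.g δ₁ δ₂ J γ ↔
        ∃ κ : ℝ, κ ^ 2 = c - 1 - δ₁ / δ₂ ∧ IsHelix S.g J γ κ 1)) := by
  obtain ⟨ε, hH⟩ := hS.sasakian.exists_hasSasakianFrame hJ_open hJ_conn hJ_ne hr hF hLegendre
    hparallel
  have hF3 := hH.isFrenetCurve hJ_open hF
  have hk1 : 1 ∈ Finset.Ico 1 r := Finset.mem_Ico.2 ⟨le_rfl, by omega⟩
  have hk0 := hF.curvature_nonneg 1 hk1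
  have hiff := hH.isInterpolatingSesquiHarmonic_iff (δ₁ := δ₁) hS hJ_open hF hLegendre hδ₂
  have hgeo := hF.isGeodesic_iff hJ_open hr
  refine ⟨⟨hH.three_le, ⟨ε, hH.sign, fun t ht => ⟨hF.frame_one t ht, hH.frame_two t ht,
    hH.frame_three t ht⟩, hF3⟩, hH.curvature_two, hH.curvature_three, fun hpos => ?_⟩,
    fun hc1 hδ => ?_, fun hc1 hδ hng => ?_⟩
  · by_contra hne
    have h3 : 3 < r := lt_of_le_of_ne hH.three_le (Ne.symm hne)
    obtain ⟨t, ht⟩ := hJ_ne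
    exact (hpos 3 (Finset.mem_Ico.2 ⟨by norm_num, h3⟩) t ht).ne' (hH.curvature_three h3 t ht)
  · rw [hiff, hgeo]
    refine ⟨fun h t ht => ?_, fun h t ht => ⟨?_, by rw [h t ht, zero_mul]⟩⟩
    · rcases mul_eq_zero.1 (h t ht).2 with h0 | h0
      · exact h0
      -- Here `k₁² = c - 1 - δ₁/δ₂ < 0`, which is impossible.
      · nlinarith [sq_nonneg (k 1 t)]
    · have : k 1 =ᶠ[nhds t] fun _ => (0 : ℝ) := by
        filter_upwards [hJ_open.mem_nhds ht] with s hs using h s hs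
      rw [this.deriv_eq, deriv_const]
  · rw [hiff]
    constructor
    · intro h
      rw [hgeo] at hng
      push Not at hng
      obtain ⟨t₀, ht₀, hne⟩ := hng
      have hconst : ∀ t ∈ J, k 1 t = k 1 t₀ := fun t ht =>
        hJ_open.is_const_of_deriv_eq_zero hJ_conn.isPreconnected
          (fun s hs => (hF.differentiableAt_curvature hJ_open hs hk1).differentiableWithinAt)
          (fun s hs => (h s hs).1) ht ht₀
      -- The non-geodesic hypothesis supplies one point with `k₁ ≠ 0`; constancy of `k₁` makes its
      -- value there the helix curvature.
      refine ⟨k 1 t₀, sub_eq_zero.1 ((mul_eq_zero.1 (h t₀ ht₀).2).resolve_left hne),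
        lt_of_le_of_ne (hk0 t₀ ht₀) (Ne.symm hne), one_pos, _,
        hF3.congr_curvature fun i _ t ht => ?_⟩
      rw [hconst t ht]
    · rintro ⟨κ, hκ, hκ0, -, F', hF'⟩
      -- The helix may come with a different frame, but `k₁ E₂` and `κ E₂'` both equal `∇_T T`;
      -- comparing norms of nonnegative multiples of unit vectors gives equality.
      have hk : ∀ t ∈ J, k 1 t = κ := by
        intro t ht
        have h1 := hF'.covDeriv_velocity hJ_open (by norm_num) ht
        rw [hF.covDeriv_velocity hJ_open hr ht, if_pos rfl] at h1
        have h2 := congrArg (fun x => S.g.inner (γ t) x x) h1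
        simp only [map_smul, smul_apply] at h2
        rw [hF.orthonormal t ht 2 (Finset.mem_Icc.2 ⟨by norm_num, hr⟩) 2
          (Finset.mem_Icc.2 ⟨by norm_num, hr⟩), hF'.orthonormal t ht 2 (by simp) 2 (by simp)] at h2
        simp only [if_true, smul_eq_mul, mul_one] at h2
        exact (mul_self_inj (hk0 t ht) hκ0.le).1 h2
      refine fun t ht => ⟨?_, by rw [hk t ht, hκ, sub_self, mul_zero]⟩
      have : k 1 =ᶠ[nhds t] fun _ => κ := by
        filter_upwards [hJ_open.mem_nhds ht] with s hs using hk s hs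
      rw [this.deriv_eq, deriv_const]
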